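/- Let $n\ge 1$, $p\ge 0$ be integers and $[n]=\{1,\dots,n\}$. For a vector $v$ let $\min(v)$, $\max(v)$ be its smallest and largest entry; for a nonnegative matrix $A$ let $\min(A^+)$ be its smallest positive entry; $\|\cdot\|$ is the Euclidean norm. *Graphs.* Let $\mathbb G_k=([n],\mathcal E_k)$, $k\ge 0$, be directed graphs. For a strongly connected directed graph $\mathbb G$, the diameter $\mathsf D(\mathbb G)$ is the largest length of a shortest directed path between two distinct nodes. A shortest-path covering $\mathcal P$ of $\mathbb G$ consists of one shortest directed path from $j$ to $\ell$ for each ordered pair of distinct nodes $j,\ell$, and $\mathsf K(\mathbb G)=\max_{\mathcal P}\max_{e\in\mathcal E}\#\{\mathbf p\in\mathcal P: e\in\mathbf p\}$ is the maximal edge-utility. (For $n=1$ there are no such pairs and the fractions in $c_k,\tau_k$ below are read as $0$.) *Assumptions.* 1. Every $\mathbb G_k$ is strongly connected. 2. Every $A_k\in\mathbb R^{n\times n}$ is (nonnegative and) row-stochastic, with $[A_k]_{ij}>0$ if $j=i$ or $(j,i)\in\mathcal E_k$ and $[A_k]_{ij}=0$ otherwise; and $a>0$ is a scalar with $\min(A_k^+)\ge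 a$ for all $k$. 3. Every $B_k\in\mathbb R^{n\times n}$ is (nonnegative and) column-stochastic, with $[B_k]_{ji}>0$ if $j=i$ or $(i,j)\in\mathcal E_k$ and $[B_k]_{ji}=0$ otherwise; and $b>0$ is a scalar with $\min(B_k^+)\ge b$ for all $k$. 4. Every $f_i:\mathbb R^p\to\mathbb R$ is continuously differentiable and $\|\nabla f_i(x)-\nabla f_i(u)\|\le L\|x-u\|$ for all $x,u$, where $L>0$. 5. $f=\frac1n\sum_{i=1}^n f_i$ satisfies $\langle\nabla f(x)-\nabla f(u),x-u\rangle\ge\mu\|x-u\|^2$ for all $x,u$, where $\mu>0$. *Method.* Given arbitrary $x_i^0\in\mathbb R^p$ and $y_i^0=\nabla f_i(x_i^0)$, let for $i\in[n]$, $k\ge0$ $$x_i^{k+1}=\sum_{j=1}^n[A_k]_{ij}x_j^k-\alpha y_i^k,\qquad y_i^{k+1}=\sum_{j=1}^n[B_k]_{ij}y_j^k+\nabla f_i(x_i^{k+1})-\nabla f_i(x_i^k),$$ with stepsize $\alpha\in\left(0,\frac{2}{nL}\right)$. *Weights.* Let $\pi_0=\frac1n\mathbf 1$ and $\pi_{k+1}=B_k\pi_k$.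 *Claim.* The function $f$ has a unique minimizer $x^*$ over $\mathbb R^p$; there is a sequence $\{\phi_k\}_{k\ge0}$ of stochastic vectors (nonnegative entries summing to $1$) with $\phi_{k+1}^{\top}A_k=\phi_k^{\top}$ for all $k\ge0$; all entries of every $\pi_k$ are positive; and for every such sequence $\{\phi_k\}$ all entries of every $\phi_k$ are positive and the following holds. Put $\hat x^k=\sum_{i=1}^n[\phi_k]_ix_i^k$, $$D(\mathbf x^k,\phi_k)=\sqrt{\sum_{i=1}^n[\phi_k]_i\|x_i^k-\hat x^k\|^2},\qquad S(\mathbf y^k,\pi_k)=\sqrt{\sum_{i=1}^n[\pi_k]_i\Big\|\tfrac{y_i^k}{[\pi_k]_i}-\sum_{\ell=1}^ny_\ell^k\Big\|^2},$$ $V_k=\big(\|\hat x^k-x^*\|,\,D(\mathbf x^k,\phi_k),\,S(\mathbf y^k,\pi_k)\big)^\top$, and $$q_k(\alpha)=\max\{|1-\alpha n\min(\pi_k)\mu|,\,|1-\alpha n\min(\pi_k)L|\},\qquad r_k=\sqrt n+\frac1{\sqrt{\min(\pi_{k+1})}},$$ $$c_k=\sqrt{1-\frac{\min(\phi_{k+1})\,a^2}{\max(\phi_k)^2\,\mathsf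 D(\mathbb G_k)\mathsf K(\mathbb G_k)}},\qquad \tau_k=\sqrt{1-\frac{\min(\pi_k)^2\,b^2}{\max(\pi_k)^2\max(\pi_{k+1})\,\mathsf D(\mathbb G_k)\mathsf K(\mathbb G_k)}},$$ $$\gamma_k=\sqrt{\max_{j\in[n]}[\phi_{k+1}]_j[\pi_k]_j},\qquad \varphi_k=\sqrt{\frac1{\min(\phi_k)}}.$$ Then for all $k\ge0$ the matrix $$M_k(\alpha)=\begin{bmatrix} q_k(\alpha) & \alpha L\sqrt n\,\varphi_k & \alpha\\ \alpha L\gamma_k\sqrt n\,\varphi_k & c_k+\alpha L\gamma_k\sqrt n\,\varphi_k & \alpha\gamma_k\\ \alpha L^2r_k\sqrt n\,\varphi_k & Lr_k(c_k\varphi_{k+1}+\varphi_k)+\alpha L^2r_k\sqrt n\,\varphi_k & \tau_k+\alpha Lr_k\end{bmatrix}$$ has nonnegative entries, and $V_{k+1}\le M_k(\alpha)V_k$ holds entrywise. -/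

import Mathlib

open scoped BigOperators Matrix

namespace PushPull

section Graphs

variable {n : ℕ}

/-- Directed walks from one node to another, edge by edge. -/
inductive DirWalk (G : Digraph (Fin n)) : Fin n → Fin n → Type
  | nil (i : Fin n) : DirWalk G i i
  | cons {i j l : Fin n} (h : G.Adj i j) (w : DirWalk G j l) : DirWalk G i l

/-- The number of edges of a walk. -/
def DirWalk.length {G : Digraph (Fin n)} : {i j : Fin n} → DirWalk G i j → ℕ
  | _, _, .nil _ => 0
  | _, _, .cons _ w => w.length + 1

/-- The list of edges of a walk. -/
def DirWalk.edges {G : Digraph (Fin n)} : {i j : Fin n} → DirWalk G i j → List (Fin n × Fin n)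
  | _, _, .nil _ => []
  | i, _, .cons (j := j) _ w => (i, j) :: w.edges

/-- There is a directed walk from every node to every node. -/
def StronglyConnected (G : Digraph (Fin n)) : Prop :=
  ∀ i j : Fin n, Nonempty (DirWalk G i j)

/-- The walk has the least number of edges among all walks with the same ends; in particular it
is then a path (it repeats no node). -/
def DirWalk.IsShortest {G : Digraph (Fin n)} {i j : Fin n} (w : DirWalk G i j) : Prop :=
  ∀ w' : DirWalk G i j, w.length ≤ w'.length

/-- The length of a shortest directed path from `i` to `j` in a strongly connected graph. -/
noncomputable def dirDist (G : Digraph (Fin n)) (i j : Fin n) : ℕ :=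
  sInf {m | ∃ w : DirWalk G i j, w.length = m}

/-- The diameter: the largest length of a shortest directed path between two distinct nodes. -/
noncomputable def diameter (G : Digraph (Fin n)) : ℕ :=
  sSup {m | ∃ i j : Fin n, i ≠ j ∧ dirDist G i j = m}

/-- A shortest-path covering: one shortest directed path for every ordered pair of distinct
nodes. -/
structure ShortestPathCovering (G : Digraph (Fin n)) where
  path : ∀ j l : Fin n, j ≠ l → DirWalk G j l
  shortest : ∀ (j l : Fin n) (h : j ≠ l), (path j l h).IsShortest

/-- The number of paths of the covering that pass through the edge `e`. -/
noncomputable def ShortestPathCovering.edgeUtility {G : Digraph (Fin n)}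
    (P : ShortestPathCovering G) (e : Fin n × Fin n) : ℕ :=
  Nat.card {q : Fin n × Fin n // ∃ h : q.1 ≠ q.2, e ∈ (P.path q.1 q.2 h).edges}

/-- The maximum edge-utility of a covering, over all edges of the graph. -/
noncomputable def ShortestPathCovering.maxUtility {G : Digraph (Fin n)}
    (P : ShortestPathCovering G) : ℕ :=
  sSup {m | ∃ e : Fin n × Fin n, G.Adj e.1 e.2 ∧ P.edgeUtility e = m}

/-- The maximal edge-utility of a graph, over all shortest-path coverings. -/
noncomputable def maxEdgeUtility (G : Digraph (Fin n)) : ℕ :=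
  sSup {m | ∃ P : ShortestPathCovering G, P.maxUtility = m}

/-- In-neighbors of `i`. -/
def inNeighbors (G : Digraph (Fin n)) (i : Fin n) : Set (Fin n) := {j | G.Adj j i}

/-- Out-neighbors of `i`. -/
def outNeighbors (G : Digraph (Fin n)) (i : Fin n) : Set (Fin n) := {j | G.Adj i j}

/-- `A i j > 0` if `j` is `i` or an in-neighbor of `i`, and `A i j = 0` otherwise. -/
def PullCompatible (G : Digraph (Fin n)) (A : Matrix (Fin n) (Fin n) ℝ) : Prop :=
  ∀ i j : Fin n, (j ∈ inNeighbors G i ∪ {i} → 0 < A i j) ∧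
    (j ∉ inNeighbors G i ∪ {i} → A i j = 0)

/-- `B j i > 0` if `j` is `i` or an out-neighbor of `i`, and `B j i = 0` otherwise. -/
def PushCompatible (G : Digraph (Fin n)) (B : Matrix (Fin n) (Fin n) ℝ) : Prop :=
  ∀ i j : Fin n, (j ∈ outNeighbors G i ∪ {i} → 0 < B j i) ∧
    (j ∉ outNeighbors G i ∪ {i} → B j i = 0)

/-- The smallest positive entry of a matrix. -/
noncomputable def minPos (M : Matrix (Fin n) (Fin n) ℝ) : ℝ :=
  sInf {t | 0 < t ∧ ∃ i j : Fin n, M i j = t}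

/-- The smallest entry of a vector. -/
noncomputable def minEntry (v : Fin n → ℝ) : ℝ := ⨅ i, v i

/-- The largest entry of a vector. -/
noncomputable def maxEntry (v : Fin n → ℝ) : ℝ := ⨆ i, v i

end Graphs

section Method

variable {n p : ℕ}

/-- The average `f = (1/n) ∑ f_i`. -/
noncomputable def avgFun (f : Fin n → EuclideanSpace ℝ (Fin p) → ℝ)
    (u : EuclideanSpace ℝ (Fin p)) : ℝ :=
  (1 / (n : ℝ)) * ∑ i, f i u

/-- Each `f_i` is continuously differentiable with `L`-Lipschitz gradient. -/
def LipschitzGradients (f : Fin n → EuclideanSpace ℝ (Fin p) → ℝ) (L : ℝ) : Prop :=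
  ∀ i, ContDiff ℝ 1 (f i) ∧ ∀ u v, ‖gradient (f i) u - gradient (f i) v‖ ≤ L * ‖u - v‖

/-- `μ`-strong convexity of a differentiable function, through its gradient. -/
def StronglyConvexGrad (F : EuclideanSpace ℝ (Fin p) → ℝ) (μ : ℝ) : Prop :=
  ∀ u v, μ * ‖u - v‖ ^ 2 ≤ inner ℝ (gradient F u - gradient F v) (u - v)

/-- The iterates `(x^k, y^k)` of the AB/Push-Pull method started at `x^0 = x0`. -/
noncomputable def iterates (A B : ℕ → Matrix (Fin n) (Fin n) ℝ)
    (f : Fin n → EuclideanSpace ℝ (Fin p) → ℝ) (α : ℝ) (x0 : Fin n → EuclideanSpace ℝ (Fin p)) :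
    ℕ → (Fin n → EuclideanSpace ℝ (Fin p)) × (Fin n → EuclideanSpace ℝ (Fin p))
  | 0 => (x0, fun i => gradient (f i) (x0 i))
  | k + 1 =>
    let x := (iterates A B f α x0 k).1
    let y := (iterates A B f α x0 k).2
    let x' : Fin n → EuclideanSpace ℝ (Fin p) := fun i => (∑ j, A k i j • x j) - α • y i
    (x', fun i => (∑ j, B k i j • y j) + gradient (f i) (x' i) - gradient (f i) (x i))

/-- `φ` is a sequence of stochastic vectors with `φ_{k+1}ᵀ A_k = φ_kᵀ` for all `k`. -/
def IsStochasticBackward (A : ℕ → Matrix (Fin n) (Fin n) ℝ) (φ : ℕ → Fin n → ℝ) : Prop :=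
  ∀ k, φ k ∈ stdSimplex ℝ (Fin n) ∧ φ (k + 1) ᵥ* A k = φ k

/-- `π_0 = (1/n) 1` and `π_{k+1} = B_k π_k`. -/
noncomputable def piSeq (B : ℕ → Matrix (Fin n) (Fin n) ℝ) : ℕ → Fin n → ℝ
  | 0 => fun _ => 1 / (n : ℝ)
  | k + 1 => B k *ᵥ piSeq B k

/-- The weighted average `∑ w_i x_i`. -/
noncomputable def wAvg (w : Fin n → ℝ) (x : Fin n → EuclideanSpace ℝ (Fin p)) :
    EuclideanSpace ℝ (Fin p) :=
  ∑ i, w i • x i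

/-- The weighted dispersion `D(x, w)` of `x` about its weighted average. -/
noncomputable def dispX (x : Fin n → EuclideanSpace ℝ (Fin p)) (w : Fin n → ℝ) : ℝ :=
  Real.sqrt (∑ i, w i * ‖x i - wAvg w x‖ ^ 2)

/-- The weighted dispersion `S(y, w)` of the scaled vectors `y_i / w_i` about `∑ y_l`. -/
noncomputable def dispY (y : Fin n → EuclideanSpace ℝ (Fin p)) (w : Fin n → ℝ) : ℝ :=
  Real.sqrt (∑ i, w i * ‖(w i)⁻¹ • y i - ∑ l, y l‖ ^ 2)

/-- The vector `V = (‖x̂ - x*‖, D(x, φ), S(y, π))`. -/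
noncomputable def errVec (xstar : EuclideanSpace ℝ (Fin p)) (φ π : Fin n → ℝ)
    (xy : (Fin n → EuclideanSpace ℝ (Fin p)) × (Fin n → EuclideanSpace ℝ (Fin p))) :
    Fin 3 → ℝ :=
  ![‖wAvg φ xy.1 - xstar‖, dispX xy.1 φ, dispY xy.2 π]

end Method

section Constants

variable {n : ℕ}

/-- `q_k(α)`, with `π = π_k`. -/
noncomputable def qConst (μ L α : ℝ) (π : Fin n → ℝ) : ℝ :=
  max |1 - α * n * minEntry π * μ| |1 - α * n * minEntry π * L|

/-- `r_k`, with `π' = π_{k+1}`. -/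
noncomputable def rConst (π' : Fin n → ℝ) : ℝ :=
  Real.sqrt n + 1 / Real.sqrt (minEntry π')

/-- `c_k`, with `G = G_k`, `φ = φ_k` and `φ' = φ_{k+1}`. -/
noncomputable def cConst (G : Digraph (Fin n)) (a : ℝ) (φ φ' : Fin n → ℝ) : ℝ :=
  Real.sqrt (1 - minEntry φ' * a ^ 2 /
    (maxEntry φ ^ 2 * (diameter G : ℝ) * (maxEdgeUtility G : ℝ)))

/-- `τ_k`, with `G = G_k`, `π = π_k` and `π' = π_{k+1}`. -/
noncomputable def tauConst (G : Digraph (Fin n)) (b : ℝ) (π π' : Fin n → ℝ) : ℝ :=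
  Real.sqrt (1 - minEntry π ^ 2 * b ^ 2 /
    (maxEntry π ^ 2 * maxEntry π' * (diameter G : ℝ) * (maxEdgeUtility G : ℝ)))

/-- `γ_k`, with `φ' = φ_{k+1}` and `π = π_k`. -/
noncomputable def gammaConst (φ' π : Fin n → ℝ) : ℝ :=
  Real.sqrt (maxEntry fun j => φ' j * π j)

/-- `φ ↦ √(1 / min φ)`. -/
noncomputable def varphiConst (φ : Fin n → ℝ) : ℝ :=
  Real.sqrt (1 / minEntry φ)

/-- The matrix `M_k(α)`, with `G = G_k`, `φ = φ_k`, `φ' = φ_{k+1}`, `π = π_k`, `π' = π_{k+1}`. -/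
noncomputable def stepMatrix (G : Digraph (Fin n)) (a b L μ α : ℝ) (φ φ' π π' : Fin n → ℝ) :
    Matrix (Fin 3) (Fin 3) ℝ :=
  let q := qConst μ L α π
  let r := rConst π'
  let c := cConst G a φ φ'
  let τ := tauConst G b π π'
  let γ := gammaConst φ' π
  let v := varphiConst φ
  let v' := varphiConst φ'
  let s := Real.sqrt n
  !![q, α * L * s * v, α;
     α * L * γ * s * v, c + α * L * γ * s * v, α * γ;
     α * L ^ 2 * r * s * v, L * r * (c * v' + v) + α * L ^ 2 * r * s * v, τ + α * L * r]

end Constants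

end PushPull

/-!
Both dispersions are weighted `ℓ²` seminorms (`wNorm`), so each coordinate of the error can be
estimated by the triangle inequality, once the mixing steps and the gradient step are understood.

*Mixing.* If `C` is row-stochastic and `φ'ᵀ C = φᵀ`, averaging with `C` keeps the weighted mean and
lowers the weighted variance by the mean of the variances of the rows
(`sum_mul_norm_mix_sub_sq`). This loss controls `‖x j - x i‖ ^ 2` for every edge from `j` to `i`.
Conversely the variance is a sum over pairs of nodes; routing the pairs along shortest paths, each
of at most `diameter G` edges and with no edge on more than `maxEdgeUtility G` of the paths, bounds
it by the sum over the edges (`sum_norm_sub_sq_le`). Hence a contraction, `wNorm_mix_sub_mean_le`.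
It applies to `A k` directly, and to `B k` in the variables `y i / π i`, in which `B k` acts as
the row-stochastic matrix with entries `B i j * π j / π' i` (`dispY_mix_le`).

*Gradient step.* The trackers satisfy `∑ y i = ∑ ∇f_i (x i)`. So the weighted average of the `x i`
moves, up to disagreement and tracking errors, by a gradient step for the average function of length
`α n ⟨φ', π⟩`. A gradient step of length `η` contracts with the factor
`max |1 - η μ| |1 - η L|` (`norm_gradient_step_le`, from the Baillon–Haddad inequality). That
`⟨φ', π⟩` may be replaced by `min π` in this factor is `max_abs_le_qConst`: for `n ≥ 2` the two add
up to at most `1`, and `α n L < 2`; for `n = 1` they are equal.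

*Weights.* The sequence `φ` exists by compactness of the simplices, and it is positive because,
going back in time, its support grows until it is full (`IsStochasticBackward.pos`). The minimizer
exists by coercivity, and is unique by strong monotonicity of the gradient.
-/

namespace PushPull

/-! ### Shortest paths and edge-utility -/

section Paths

variable {n : ℕ} {G : Digraph (Fin n)}

theorem DirWalk.adj_of_mem_edges {i j : Fin n} (w : DirWalk G i j) :
    ∀ e ∈ w.edges, G.Adj e.1 e.2 := by
  induction w with
  | nil i => simp [DirWalk.edges]
  | cons h w ih =>
    intro e he
    rcases List.mem_cons.1 he with rfl | he
    · exact h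
    · exact ih e he

/-- Cutting a walk at the start of one of its edges leaves a walk that is no longer. -/
theorem DirWalk.exists_suffix {i j : Fin n} (w : DirWalk G i j) :
    ∀ e ∈ w.edges, ∃ w' : DirWalk G e.1 j, w'.length ≤ w.length := by
  induction w with
  | nil i => simp [DirWalk.edges]
  | cons h w ih =>
    intro e he
    rcases List.mem_cons.1 he with rfl | he
    · exact ⟨.cons h w, le_rfl⟩
    · obtain ⟨w', hw'⟩ := ih e he
      exact ⟨w', hw'.trans (Nat.le_succ _)⟩

/-- A shortest walk uses no edge twice, since a second use would allow a shortcut. -/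
theorem DirWalk.IsShortest.nodup_edges {i j : Fin n} {w : DirWalk G i j} (hw : w.IsShortest) :
    w.edges.Nodup := by
  induction w with
  | nil i => simp [DirWalk.edges]
  | cons h w ih =>
    refine List.nodup_cons.2 ⟨fun hmem => ?_, ih fun w' => ?_⟩
    · obtain ⟨w', hw'⟩ := w.exists_suffix _ hmem
      have := hw w'
      simp only [DirWalk.length] at this
      omega
    · have := hw (.cons h w')
      simp only [DirWalk.length] at this
      omega

theorem DirWalk.IsShortest.length_eq_dirDist {i j : Fin n} {w : DirWalk G i j}
    (hw : w.IsShortest) : w.length = dirDist G i j := by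
  refine le_antisymm (le_csInf ⟨_, w, rfl⟩ ?_) (Nat.sInf_le ⟨w, rfl⟩)
  rintro _ ⟨w', rfl⟩
  exact hw w'

theorem dirDist_le_diameter {i j : Fin n} (h : i ≠ j) : dirDist G i j ≤ diameter G := by
  refine le_csSup (Set.Finite.bddAbove ?_) ⟨i, j, h, rfl⟩
  refine (Set.finite_range fun q : Fin n × Fin n => dirDist G q.1 q.2).subset ?_
  rintro _ ⟨i, j, -, rfl⟩
  exact ⟨(i, j), rfl⟩

theorem StronglyConnected.nonempty_covering (hG : StronglyConnected G) :
    Nonempty (ShortestPathCovering G) := by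
  have h : ∀ j l : Fin n, ∃ w : DirWalk G j l, w.IsShortest := fun j l => by
    obtain ⟨w₀⟩ := hG j l
    obtain ⟨w, hw⟩ := Nat.sInf_mem (s := {m | ∃ w : DirWalk G j l, w.length = m}) ⟨_, w₀, rfl⟩
    exact ⟨w, fun w' => hw ▸ Nat.sInf_le ⟨w', rfl⟩⟩
  choose w hw using h
  exact ⟨⟨fun j l _ => w j l, fun j l _ => hw j l⟩⟩

theorem ShortestPathCovering.edgeUtility_le_sq (P : ShortestPathCovering G)
    (e : Fin n × Fin n) : P.edgeUtility e ≤ n * n := by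
  refine (Finite.card_subtype_le _).trans ?_
  simp

theorem ShortestPathCovering.edgeUtility_le_maxEdgeUtility (P : ShortestPathCovering G)
    {e : Fin n × Fin n} (he : G.Adj e.1 e.2) : P.edgeUtility e ≤ maxEdgeUtility G := by
  have hbdd (Q : ShortestPathCovering G) :
      n * n ∈ upperBounds {m | ∃ e : Fin n × Fin n, G.Adj e.1 e.2 ∧ Q.edgeUtility e = m} := by
    rintro _ ⟨e, -, rfl⟩
    exact Q.edgeUtility_le_sq e
  refine (le_csSup ⟨_, hbdd P⟩ ⟨e, he, rfl⟩).trans (le_csSup ⟨n * n, ?_⟩ ⟨P, rfl⟩)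
  rintro _ ⟨Q, rfl⟩
  exact csSup_le' (hbdd Q)

variable {E : Type*} [SeminormedAddCommGroup E]

/-- The Cauchy–Schwarz inequality along a walk. -/
theorem DirWalk.norm_sub_sq_le (x : Fin n → E) {i j : Fin n} (w : DirWalk G i j) :
    ‖x i - x j‖ ^ 2 ≤ w.length * (w.edges.map fun e => ‖x e.1 - x e.2‖ ^ 2).sum := by
  induction w with
  | nil i => simp [DirWalk.edges]
  | @cons i m j h w ih =>
    simp only [DirWalk.length, DirWalk.edges, List.map_cons, List.sum_cons, Nat.cast_add,
      Nat.cast_one]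
    set S := (w.edges.map fun e => ‖x e.1 - x e.2‖ ^ 2).sum
    have hS : 0 ≤ S := List.sum_nonneg <| by
      simp only [List.mem_map]
      rintro _ ⟨e, -, rfl⟩
      positivity
    have htri : ‖x i - x j‖ ≤ ‖x i - x m‖ + ‖x m - x j‖ := norm_sub_le_norm_sub_add_norm_sub _ _ _
    set u := ‖x i - x m‖
    set v := ‖x m - x j‖
    have hu : 0 ≤ u := norm_nonneg _
    have hv : 0 ≤ v := norm_nonneg _
    have hl : (0 : ℝ) ≤ w.length := Nat.cast_nonneg _
    -- the cross term, from `v ^ 2 ≤ length * S` by the inequality of the two means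
    have hcross : 2 * (u * v) ≤ w.length * u ^ 2 + S := by
      refine abs_le_of_sq_le_sq' ?_ (by positivity) |>.2
      nlinarith [mul_le_mul_of_nonneg_left ih (sq_nonneg u), sq_nonneg (w.length * u ^ 2 - S)]
    nlinarith [pow_le_pow_left₀ (norm_nonneg (x i - x j)) htri 2]

open Classical in
/-- Routing every ordered pair of nodes along a shortest path bounds all differences by those along
the edges: a path has at most `diameter G` edges, and an edge lies on at most `maxEdgeUtility G`
paths. -/
theorem sum_norm_sub_sq_le (hG : StronglyConnected G) (x : Fin n → E) :
    ∑ j, ∑ l, ‖x j - x l‖ ^ 2 ≤ (diameter G * maxEdgeUtility G : ℝ) *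
      ∑ j, ∑ i, if G.Adj j i then ‖x j - x i‖ ^ 2 else 0 := by
  obtain ⟨P⟩ := hG.nonempty_covering
  set d : Fin n × Fin n → ℝ := fun e => ‖x e.1 - x e.2‖ ^ 2 with hd
  have hd0 (e) : 0 ≤ d e := sq_nonneg _
  have hpair (q : Fin n × Fin n) : d q ≤ diameter G *
      ∑ e, if ∃ h : q.1 ≠ q.2, e ∈ (P.path q.1 q.2 h).edges then d e else 0 := by
    by_cases h : q.1 = q.2
    · simp [hd, h]
    · have hs := P.shortest q.1 q.2 h
      refine ((P.path q.1 q.2 h).norm_sub_sq_le x).trans ?_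
      rw [← List.sum_toFinset _ hs.nodup_edges, hs.length_eq_dirDist]
      have heq : (∑ e, if ∃ h : q.1 ≠ q.2, e ∈ (P.path q.1 q.2 h).edges then d e else 0) =
          ∑ e ∈ (P.path q.1 q.2 h).edges.toFinset, d e := by
        rw [← Finset.sum_filter]
        refine Finset.sum_congr (Finset.ext fun e => ?_) fun _ _ => rfl
        simp [h]
      rw [heq]
      exact mul_le_mul_of_nonneg_right (Nat.cast_le.2 (dirDist_le_diameter h))
        (Finset.sum_nonneg fun e _ => hd0 e)
  have hedge (e : Fin n × Fin n) :
      (∑ q : Fin n × Fin n, if ∃ h : q.1 ≠ q.2, e ∈ (P.path q.1 q.2 h).edges then d e else 0) ≤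
        maxEdgeUtility G * if G.Adj e.1 e.2 then d e else 0 := by
    by_cases he : G.Adj e.1 e.2
    · rw [if_pos he, ← Finset.sum_filter, Finset.sum_const, nsmul_eq_mul]
      refine mul_le_mul_of_nonneg_right (Nat.cast_le.2 ?_) (hd0 e)
      refine le_trans (le_of_eq ?_) (P.edgeUtility_le_maxEdgeUtility he)
      rw [ShortestPathCovering.edgeUtility, Nat.card_eq_fintype_card, Fintype.card_subtype]
    · rw [if_neg he, mul_zero]
      refine (Finset.sum_eq_zero fun q _ => if_neg ?_).le
      rintro ⟨h, hmem⟩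
      exact he ((P.path q.1 q.2 h).adj_of_mem_edges e hmem)
  calc ∑ j, ∑ l, ‖x j - x l‖ ^ 2 = ∑ q, d q := (Fintype.sum_prod_type d).symm
    _ ≤ ∑ q : Fin n × Fin n, (diameter G : ℝ) *
        ∑ e, if ∃ h : q.1 ≠ q.2, e ∈ (P.path q.1 q.2 h).edges then d e else 0 :=
      Finset.sum_le_sum fun q _ => hpair q
    _ = diameter G * ∑ e, ∑ q : Fin n × Fin n,
        if ∃ h : q.1 ≠ q.2, e ∈ (P.path q.1 q.2 h).edges then d e else 0 := by
      rw [← Finset.mul_sum, Finset.sum_comm]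
    _ ≤ diameter G * ∑ e : Fin n × Fin n,
        (maxEdgeUtility G : ℝ) * if G.Adj e.1 e.2 then d e else 0 :=
      mul_le_mul_of_nonneg_left (Finset.sum_le_sum fun e _ => hedge e) (Nat.cast_nonneg _)
    _ = _ := by rw [← Finset.mul_sum, Fintype.sum_prod_type, mul_assoc]

end Paths

/-! ### Weighted norms -/

section WeightedNorm

variable {ι E : Type*} [Fintype ι] [NormedAddCommGroup E]

/-- The weighted `ℓ²` seminorm of a family of vectors, for nonnegative weights. Both dispersions
are of this form. -/
noncomputable def wNorm (w : ι → ℝ) (x : ι → E) : ℝ := √(∑ i, w i * ‖x i‖ ^ 2)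

theorem wNorm_neg (w : ι → ℝ) (x : ι → E) : wNorm w (fun i => -x i) = wNorm w x := by
  simp [wNorm]

theorem wNorm_le_mul {w w' : ι → ℝ} {x z : ι → E} {C : ℝ} (hC : 0 ≤ C)
    (h : ∀ i, w i * ‖x i‖ ^ 2 ≤ C ^ 2 * (w' i * ‖z i‖ ^ 2)) : wNorm w x ≤ C * wNorm w' z := by
  have := Real.sqrt_le_sqrt (Finset.sum_le_sum fun i (_ : i ∈ Finset.univ) => h i)
  rwa [← Finset.mul_sum, Real.sqrt_mul (sq_nonneg C), Real.sqrt_sq hC] at this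

theorem wNorm_const {w : ι → ℝ} (hw : ∑ i, w i = 1) (v : E) : wNorm w (fun _ => v) = ‖v‖ := by
  rw [wNorm, ← Finset.sum_mul, hw, one_mul, Real.sqrt_sq (norm_nonneg v)]

theorem sum_norm_le_sqrt_card_mul_wNorm (x : ι → E) :
    ∑ i, ‖x i‖ ≤ √(Fintype.card ι) * wNorm (fun _ => 1) x := by
  rw [wNorm, ← Real.sqrt_mul (Nat.cast_nonneg _)]
  refine Real.le_sqrt_of_sq_le ?_
  simpa using sq_sum_le_card_mul_sum_sq (s := Finset.univ) (f := fun i => ‖x i‖)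

variable [InnerProductSpace ℝ E]

theorem wNorm_eq_norm {w : ι → ℝ} (hw : ∀ i, 0 ≤ w i) (x : ι → E) :
    wNorm w x = ‖WithLp.toLp 2 fun i => √(w i) • x i‖ := by
  rw [PiLp.norm_eq_of_L2, wNorm]
  congr 1
  refine Finset.sum_congr rfl fun i _ => ?_
  rw [norm_smul, mul_pow, Real.norm_eq_abs, sq_abs, Real.sq_sqrt (hw i)]

theorem wNorm_add_le {w : ι → ℝ} (hw : ∀ i, 0 ≤ w i) (x y : ι → E) :
    wNorm w (fun i => x i + y i) ≤ wNorm w x + wNorm w y := by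
  rw [wNorm_eq_norm hw, wNorm_eq_norm hw, wNorm_eq_norm hw]
  refine le_trans (le_of_eq ?_) (norm_add_le _ _)
  congr 1
  ext i
  simp

theorem wNorm_sub_le {w : ι → ℝ} (hw : ∀ i, 0 ≤ w i) (x y : ι → E) :
    wNorm w (fun i => x i - y i) ≤ wNorm w x + wNorm w y := by
  simpa [sub_eq_add_neg, wNorm_neg] using wNorm_add_le hw x fun i => -y i

theorem wNorm_smul (w : ι → ℝ) {c : ℝ} (hc : 0 ≤ c) (x : ι → E) :
    wNorm w (fun i => c • x i) = c * wNorm w x := by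
  rw [wNorm, wNorm, ← Real.sqrt_sq hc, ← Real.sqrt_mul (sq_nonneg c), Finset.mul_sum,
    Real.sqrt_sq hc]
  congr 1
  refine Finset.sum_congr rfl fun i _ => ?_
  rw [norm_smul, mul_pow, Real.norm_eq_abs, sq_abs]
  ring

/-- The second moment about `c` is the variance plus the squared distance of `c` to the mean. -/
theorem sum_mul_norm_sub_sq {w : ι → ℝ} (hw : ∑ i, w i = 1) (x : ι → E) (c : E) :
    ∑ i, w i * ‖x i - c‖ ^ 2 =
      ∑ i, w i * ‖x i - ∑ j, w j • x j‖ ^ 2 + ‖(∑ j, w j • x j) - c‖ ^ 2 := by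
  set m := ∑ j, w j • x j with hm
  have hcross : ∑ i, w i * inner ℝ (x i - m) (m - c) = 0 := by
    have : ∑ i, w i • (x i - m) = 0 := by
      simp only [smul_sub, Finset.sum_sub_distrib, ← Finset.sum_smul, hw, one_smul, ← hm, sub_self]
    simp only [← real_inner_smul_left]
    rw [← sum_inner, this, inner_zero_left]
  have hterm (i : ι) : w i * ‖x i - c‖ ^ 2 =
      w i * ‖x i - m‖ ^ 2 + 2 * (w i * inner ℝ (x i - m) (m - c)) + w i * ‖m - c‖ ^ 2 := by
    rw [← sub_add_sub_cancel (x i) m c, norm_add_sq_real]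
    ring
  simp only [hterm, Finset.sum_add_distrib, ← Finset.mul_sum, ← Finset.sum_mul, hcross, hw]
  ring

theorem sum_sum_mul_norm_sub_sq {w : ι → ℝ} (hw : ∑ i, w i = 1) (x : ι → E) :
    ∑ j, ∑ l, w j * w l * ‖x j - x l‖ ^ 2 = 2 * ∑ i, w i * ‖x i - ∑ j, w j • x j‖ ^ 2 := by
  have hrow (l : ι) : ∑ j, w j * w l * ‖x j - x l‖ ^ 2 = w l *
      (∑ i, w i * ‖x i - ∑ j, w j • x j‖ ^ 2) + w l * ‖x l - ∑ j, w j • x j‖ ^ 2 := by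
    rw [← norm_sub_rev, ← mul_add, ← sum_mul_norm_sub_sq hw x (x l), Finset.mul_sum]
    exact Finset.sum_congr rfl fun j _ => by ring
  rw [Finset.sum_comm]
  simp only [hrow, Finset.sum_add_distrib, ← Finset.sum_mul, hw]
  ring

theorem norm_sum_smul_le_wNorm {w : ι → ℝ} (hw0 : ∀ i, 0 ≤ w i) (hw : ∑ i, w i = 1) (x : ι → E) :
    ‖∑ i, w i • x i‖ ≤ wNorm w x := by
  refine Real.le_sqrt_of_sq_le ?_
  have h := sum_mul_norm_sub_sq hw x 0
  simp only [sub_zero] at h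
  rw [h]
  exact le_add_of_nonneg_left (Finset.sum_nonneg fun i _ => mul_nonneg (hw0 i) (sq_nonneg _))

theorem wNorm_sub_mean_le {w : ι → ℝ} (hw : ∑ i, w i = 1) (x : ι → E) :
    wNorm w (fun i => x i - ∑ j, w j • x j) ≤ wNorm w x := by
  refine Real.sqrt_le_sqrt ?_
  have h := sum_mul_norm_sub_sq hw x 0
  simp only [sub_zero] at h
  rw [h]
  exact le_add_of_nonneg_right (sq_nonneg _)

/-- Averaging with the rows of `C` lowers the weighted variance by the mean variance of the rows. -/
theorem sum_mul_norm_mix_sub_sq {φ φ' : ι → ℝ} {C : Matrix ι ι ℝ} (hC1 : ∀ i, ∑ j, C i j = 1)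
    (hφ : ∀ j, ∑ i, φ' i * C i j = φ j) (x : ι → E) (c : E) :
    ∑ i, φ' i * ‖(∑ j, C i j • x j) - c‖ ^ 2 = ∑ j, φ j * ‖x j - c‖ ^ 2 -
      (∑ i, ∑ j, ∑ l, φ' i * (C i j * C i l) * ‖x j - x l‖ ^ 2) / 2 := by
  have hrow (i : ι) : φ' i * ‖(∑ j, C i j • x j) - c‖ ^ 2 =
      ∑ j, φ' i * C i j * ‖x j - c‖ ^ 2 -
        (∑ j, ∑ l, φ' i * (C i j * C i l) * ‖x j - x l‖ ^ 2) / 2 := by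
    have h1 := sum_mul_norm_sub_sq (hC1 i) x c
    have h2 := sum_sum_mul_norm_sub_sq (hC1 i) x
    simp only [mul_assoc, ← Finset.mul_sum] at h1 h2 ⊢
    rw [h1, h2]
    ring
  simp only [hrow, Finset.sum_sub_distrib, ← Finset.sum_div]
  rw [Finset.sum_comm]
  simp only [← Finset.sum_mul, hφ]

end WeightedNorm

/-! ### Extreme entries -/

section Entries

variable {n : ℕ}

theorem minEntry_le (v : Fin n → ℝ) (i : Fin n) : minEntry v ≤ v i :=
  ciInf_le (Set.finite_range v).bddBelow i

theorem le_maxEntry (v : Fin n → ℝ) (i : Fin n) : v i ≤ maxEntry v :=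
  le_ciSup (Set.finite_range v).bddAbove i

theorem minEntry_pos [NeZero n] {v : Fin n → ℝ} (hv : ∀ i, 0 < v i) : 0 < minEntry v := by
  obtain ⟨i, hi⟩ := exists_eq_ciInf_of_finite (f := v)
  exact (hv i).trans_eq hi

theorem maxEntry_pos [NeZero n] {v : Fin n → ℝ} (hv : ∀ i, 0 < v i) : 0 < maxEntry v :=
  (hv 0).trans_le (le_maxEntry v 0)

theorem minPos_le {M : Matrix (Fin n) (Fin n) ℝ} {i j : Fin n} (h : 0 < M i j) :
    minPos M ≤ M i j :=
  csInf_le ⟨0, fun _ ht => ht.1.le⟩ ⟨h, i, j, rfl⟩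

end Entries

/-! ### Contraction of the dispersions -/

section Contraction

variable {n : ℕ} {G : Digraph (Fin n)} {E : Type*} [NormedAddCommGroup E] [InnerProductSpace ℝ E]

/-- The variance bounds, up to the factor of the path covering, the variance lost in the averaging:
the loss contains `φ' i * C i j * C i i * ‖x j - x i‖ ^ 2` for each edge from `j` to `i`. -/
theorem wNorm_mix_sub_mean_le (hG : StronglyConnected G) {φ φ' : Fin n → ℝ}
    {C : Matrix (Fin n) (Fin n) ℝ} (hφ'0 : ∀ i, 0 ≤ φ' i) (hφ0 : ∀ i, 0 ≤ φ i)
    (hφ1 : ∑ i, φ i = 1) (hC0 : ∀ i j, 0 ≤ C i j) (hC1 : ∀ i, ∑ j, C i j = 1)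
    (hφ : ∀ j, ∑ i, φ' i * C i j = φ j) {m : ℝ} (hm0 : 0 ≤ m)
    (hm : ∀ i j, G.Adj j i → m ≤ φ' i * (C i j * C i i)) (x : Fin n → E) :
    wNorm φ' (fun i => (∑ j, C i j • x j) - ∑ j, φ j • x j) ≤
      √(1 - m / (maxEntry φ ^ 2 * (diameter G : ℝ) * (maxEdgeUtility G : ℝ))) *
        wNorm φ (fun i => x i - ∑ j, φ j • x j) := by
  classical
  set Q : ℝ := maxEntry φ ^ 2 * (diameter G : ℝ) * (maxEdgeUtility G : ℝ) with hQ
  set V := ∑ j, φ j * ‖x j - ∑ l, φ l • x l‖ ^ 2 with hV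
  set W := ∑ i, ∑ j, ∑ l, φ' i * (C i j * C i l) * ‖x j - x l‖ ^ 2 with hW
  set T := ∑ j, ∑ i, if G.Adj j i then ‖x j - x i‖ ^ 2 else 0 with hT
  have hT0 : 0 ≤ T := Finset.sum_nonneg fun j _ => Finset.sum_nonneg fun i _ => by
    split_ifs <;> positivity
  have hV0 : 0 ≤ V := Finset.sum_nonneg fun i _ => mul_nonneg (hφ0 i) (sq_nonneg _)
  have hVT : 2 * V ≤ Q * T := by
    have hφM (j : Fin n) : φ j ≤ maxEntry φ := le_maxEntry φ j
    calc 2 * V = ∑ j, ∑ l, φ j * φ l * ‖x j - x l‖ ^ 2 := (sum_sum_mul_norm_sub_sq hφ1 x).symm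
      _ ≤ ∑ j, ∑ l, maxEntry φ ^ 2 * ‖x j - x l‖ ^ 2 := by
        refine Finset.sum_le_sum fun j _ => Finset.sum_le_sum fun l _ => ?_
        refine mul_le_mul_of_nonneg_right ?_ (sq_nonneg _)
        rw [sq]
        exact mul_le_mul (hφM j) (hφM l) (hφ0 l) ((hφ0 j).trans (hφM j))
      _ = maxEntry φ ^ 2 * ∑ j, ∑ l, ‖x j - x l‖ ^ 2 := by simp only [Finset.mul_sum]
      _ ≤ maxEntry φ ^ 2 * ((diameter G * maxEdgeUtility G : ℝ) * T) :=
        mul_le_mul_of_nonneg_left (sum_norm_sub_sq_le hG x) (sq_nonneg _)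
      _ = Q * T := by rw [hQ]; ring
  have hnn (i j l : Fin n) : 0 ≤ φ' i * (C i j * C i l) * ‖x j - x l‖ ^ 2 :=
    mul_nonneg (mul_nonneg (hφ'0 i) (mul_nonneg (hC0 i j) (hC0 i l))) (sq_nonneg _)
  have hTW : m * T ≤ W := by
    rw [hT, Finset.sum_comm, Finset.mul_sum]
    refine Finset.sum_le_sum fun i _ => ?_
    rw [Finset.mul_sum]
    refine Finset.sum_le_sum fun j _ => ?_
    split_ifs with h
    · exact (mul_le_mul_of_nonneg_right (hm i j h) (sq_nonneg _)).trans
        (Finset.single_le_sum (f := fun l => φ' i * (C i j * C i l) * ‖x j - x l‖ ^ 2)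
          (fun l _ => hnn i j l) (Finset.mem_univ i))
    · rw [mul_zero]
      exact Finset.sum_nonneg fun l _ => hnn i j l
  have hgain : m / Q * V ≤ W / 2 := by
    have hQ0 : 0 ≤ Q := by positivity
    rcases hQ0.eq_or_lt with h0 | hpos
    · rw [← h0, div_zero, zero_mul]
      exact div_nonneg ((mul_nonneg hm0 hT0).trans hTW) zero_le_two
    · rw [div_mul_eq_mul_div, div_le_iff₀ hpos]
      nlinarith [mul_le_mul_of_nonneg_left hVT hm0, mul_le_mul_of_nonneg_left hTW hpos.le]
  have hmix := sum_mul_norm_mix_sub_sq hC1 hφ x (∑ j, φ j • x j)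
  rw [wNorm, wNorm, ← Real.sqrt_mul' _ hV0, hmix]
  exact Real.sqrt_le_sqrt (by linarith)

end Contraction

/-! ### Strongly convex functions with Lipschitz gradient -/

theorem le_of_strongly_monotone_lipschitz {E : Type*} [NormedAddCommGroup E]
    [InnerProductSpace ℝ E] [Nontrivial E] {g : E → E} {μ L : ℝ}
    (hμ : ∀ u v, μ * ‖u - v‖ ^ 2 ≤ inner ℝ (g u - g v) (u - v))
    (hL : ∀ u v, ‖g u - g v‖ ≤ L * ‖u - v‖) : μ ≤ L := by
  obtain ⟨u, hu⟩ := exists_ne (0 : E)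
  have h1 := hμ u 0
  have h2 := real_inner_le_norm (g u - g 0) (u - 0)
  have h3 := mul_le_mul_of_nonneg_right (hL u 0) (norm_nonneg (u - 0))
  rw [sub_zero] at *
  have : 0 < ‖u‖ ^ 2 := by positivity
  nlinarith

section Convex

variable {E : Type*} [NormedAddCommGroup E] [InnerProductSpace ℝ E] [CompleteSpace E]
  {F : E → ℝ} {g : E → E}

/-- The quadratic lower bound implied by a one-sided bound on the gradient; `c` may be negative,
so that the upper bound for a Lipschitz gradient is the case of `-F`. -/
theorem quadratic_lower_bound (hF : ∀ u, HasGradientAt F (g u) u) {c : ℝ}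
    (hc : ∀ u v, c * ‖u - v‖ ^ 2 ≤ inner ℝ (g u - g v) (u - v)) (x z : E) :
    F x + inner ℝ (g x) (z - x) + c / 2 * ‖z - x‖ ^ 2 ≤ F z := by
  set v := z - x with hv
  set ψ : ℝ → ℝ := fun t => F (x + t • v) - t * inner ℝ (g x) v - c / 2 * ‖v‖ ^ 2 * t ^ 2 with hψ
  have hline (t : ℝ) : HasDerivAt (fun t : ℝ => x + t • v) v t := by
    simpa using ((hasDerivAt_id t).smul_const v).const_add x
  have hder (t : ℝ) : HasDerivAt ψ
      (inner ℝ (g (x + t • v)) v - inner ℝ (g x) v - c / 2 * ‖v‖ ^ 2 * (2 * t)) t := by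
    have h1 := (hF (x + t • v)).hasFDerivAt.comp_hasDerivAt t (hline t)
    have h2 := (hasDerivAt_id t).mul_const (inner ℝ (g x) v)
    have h3 := (hasDerivAt_pow 2 t).const_mul (c / 2 * ‖v‖ ^ 2)
    refine ((h1.sub h2).sub h3).congr_deriv ?_
    simp
  have hmono : MonotoneOn ψ (Set.Icc 0 1) := by
    refine monotoneOn_of_deriv_nonneg (convex_Icc 0 1)
      (fun t _ => (hder t).continuousAt.continuousWithinAt)
      (fun t _ => (hder t).differentiableAt.differentiableWithinAt) fun t ht => ?_
    rw [interior_Icc] at ht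
    rw [(hder t).deriv]
    have h := hc (x + t • v) x
    rw [add_sub_cancel_left, norm_smul, inner_smul_right, inner_sub_left, Real.norm_eq_abs,
      mul_pow, sq_abs] at h
    have h' : t * (c * t * ‖v‖ ^ 2) ≤ t * (inner ℝ (g (x + t • v)) v - inner ℝ (g x) v) := by
      linarith
    have := le_of_mul_le_mul_left h' ht.1
    linarith
  have h01 := hmono (Set.left_mem_Icc.2 zero_le_one) (Set.right_mem_Icc.2 zero_le_one) zero_le_one
  simp only [hψ, zero_smul, add_zero, one_smul, hv, add_sub_cancel] at h01
  simp only [hv]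
  linarith

theorem quadratic_upper_bound (hF : ∀ u, HasGradientAt F (g u) u) {L : ℝ}
    (hL : ∀ u v, ‖g u - g v‖ ≤ L * ‖u - v‖) (x z : E) :
    F z ≤ F x + inner ℝ (g x) (z - x) + L / 2 * ‖z - x‖ ^ 2 := by
  have hF' : ∀ u, HasGradientAt (fun v => -F v) (-g u) u := fun u => by
    have h := (hF u).hasFDerivAt.neg
    rw [hasGradientAt_iff_hasFDerivAt, map_neg]
    exact h
  have h := quadratic_lower_bound (c := -L) hF' (fun u v => ?_) x z
  · rw [inner_neg_left] at h
    linarith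
  · have h1 := real_inner_le_norm (g u - g v) (u - v)
    have h2 := mul_le_mul_of_nonneg_right (hL u v) (norm_nonneg (u - v))
    have h3 : -g u - -g v = -(g u - g v) := by abel
    rw [h3, inner_neg_left]
    linarith [sq ‖u - v‖, mul_assoc L ‖u - v‖ ‖u - v‖]

/-- The sharp form of monotonicity and Lipschitz continuity together: the gradient differences lie
in the ball with diameter `[μ (u - v), L (u - v)]`. It is the Baillon–Haddad inequality for
`F - μ / 2 * ‖·‖ ^ 2`. -/
theorem inner_sub_smul_nonneg (hF : ∀ u, HasGradientAt F (g u) u) {μ L : ℝ}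
    (hμ : ∀ u v, μ * ‖u - v‖ ^ 2 ≤ inner ℝ (g u - g v) (u - v))
    (hL : ∀ u v, ‖g u - g v‖ ≤ L * ‖u - v‖) (hμL : μ ≤ L) (u v : E) :
    0 ≤ inner ℝ ((g u - g v) - μ • (u - v)) (L • (u - v) - (g u - g v)) := by
  -- comparing the two quadratic bounds at the point `y - t • δ`
  have key (x y : E) (t : ℝ) :
      F x + inner ℝ (g x) (y - x) + μ / 2 * ‖y - x‖ ^ 2 + (t - (L - μ) / 2 * t ^ 2) *
        ‖(g y - g x) - μ • (y - x)‖ ^ 2 ≤ F y := by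
    set δ := (g y - g x) - μ • (y - x) with hδ
    have h1 := quadratic_lower_bound hF hμ x (y - t • δ)
    have h2 := quadratic_upper_bound hF hL y (y - t • δ)
    have e1 : y - t • δ - y = -(t • δ) := by abel
    have e2 : y - t • δ - x = (y - x) - t • δ := by abel
    rw [e2, norm_sub_sq_real, inner_sub_right, inner_smul_right, inner_smul_right, norm_smul,
      mul_pow, Real.norm_eq_abs, sq_abs] at h1
    rw [e1, norm_neg, norm_smul, inner_neg_right, inner_smul_right, mul_pow, Real.norm_eq_abs,
      sq_abs] at h2
    have h3 : ‖δ‖ ^ 2 = inner ℝ (g y) δ - inner ℝ (g x) δ - μ * inner ℝ (y - x) δ := by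
      rw [← real_inner_self_eq_norm_sq]
      nth_rewrite 1 [hδ]
      rw [inner_sub_left, inner_sub_left, inner_smul_left]
      simp
    have h4 : t * ‖δ‖ ^ 2 = t * (inner ℝ (g y) δ - inner ℝ (g x) δ - μ * inner ℝ (y - x) δ) := by
      rw [h3]
    linarith
  have hsum (t : ℝ) : (2 * t - (L - μ) * t ^ 2) * ‖(g u - g v) - μ • (u - v)‖ ^ 2 ≤
      inner ℝ ((g u - g v) - μ • (u - v)) (u - v) := by
    have h1 := key u v t
    have h2 := key v u t
    have e1 : (g v - g u) - μ • (v - u) = -((g u - g v) - μ • (u - v)) := by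
      rw [← neg_sub u v, ← neg_sub (g u) (g v), smul_neg]; abel
    rw [e1, norm_neg, ← neg_sub u v, norm_neg, inner_neg_right] at h1
    rw [inner_sub_left, inner_smul_left, real_inner_self_eq_norm_sq, inner_sub_left]
    simp only [RCLike.conj_to_real]
    linarith
  set δ := (g u - g v) - μ • (u - v) with hδ
  have e : L • (u - v) - (g u - g v) = (L - μ) • (u - v) - δ := by
    rw [hδ, sub_smul]; abel
  rw [e, inner_sub_right, inner_smul_right, real_inner_self_eq_norm_sq]
  rcases hμL.eq_or_lt with rfl | hlt
  · -- here the inner product vanishes, and with it `δ`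
    have h1 := hsum 1
    have h2 : inner ℝ δ (u - v) ≤ 0 := by
      have h3 := real_inner_le_norm (g u - g v) (u - v)
      have h4 := mul_le_mul_of_nonneg_right (hL u v) (norm_nonneg (u - v))
      rw [hδ, inner_sub_left, inner_smul_left, real_inner_self_eq_norm_sq]
      simp only [RCLike.conj_to_real]
      linarith [sq ‖u - v‖, mul_assoc μ ‖u - v‖ ‖u - v‖]
    nlinarith [sq_nonneg ‖δ‖]
  · have hpos : 0 < L - μ := sub_pos.2 hlt
    have h1 := mul_le_mul_of_nonneg_left (hsum (1 / (L - μ))) hpos.le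
    have h2 : (L - μ) * ((2 * (1 / (L - μ)) - (L - μ) * (1 / (L - μ)) ^ 2) * ‖δ‖ ^ 2) =
        ‖δ‖ ^ 2 := by
      field_simp
      ring
    linarith

/-- A gradient step of length `η ≥ 0` contracts with the factor `max |1 - η μ| |1 - η L|`. -/
theorem norm_gradient_step_le (hF : ∀ u, HasGradientAt F (g u) u) {μ L : ℝ}
    (hμ : ∀ u v, μ * ‖u - v‖ ^ 2 ≤ inner ℝ (g u - g v) (u - v))
    (hL : ∀ u v, ‖g u - g v‖ ≤ L * ‖u - v‖) (hμL : μ ≤ L) {η : ℝ} (hη : 0 ≤ η) (u v : E) :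
    ‖(u - v) - η • (g u - g v)‖ ≤ max |1 - η * μ| |1 - η * L| * ‖u - v‖ := by
  have h := inner_sub_smul_nonneg hF hμ hL hμL u v
  set d := u - v
  set w := g u - g v
  have hball : ‖w - ((μ + L) / 2) • d‖ ≤ (L - μ) / 2 * ‖d‖ := by
    refine abs_le_of_sq_le_sq' ?_ (by have := norm_nonneg d; nlinarith) |>.2
    rw [norm_sub_sq_real, inner_smul_right, norm_smul, mul_pow, Real.norm_eq_abs, sq_abs]
    simp only [inner_sub_left, inner_sub_right, inner_smul_left, inner_smul_right,
      RCLike.conj_to_real, real_inner_self_eq_norm_sq] at h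
    rw [real_inner_comm w d] at h
    linarith
  have hsplit : d - η • w = (1 - η * ((μ + L) / 2)) • d - η • (w - ((μ + L) / 2) • d) := by
    module
  calc ‖d - η • w‖ ≤ |1 - η * ((μ + L) / 2)| * ‖d‖ + η * ((L - μ) / 2 * ‖d‖) := by
        rw [hsplit]
        refine (norm_sub_le _ _).trans (add_le_add (norm_smul _ _).le ?_)
        rw [norm_smul, Real.norm_of_nonneg hη]
        exact mul_le_mul_of_nonneg_left hball hη
    _ = (|1 - η * ((μ + L) / 2)| + η * ((L - μ) / 2)) * ‖d‖ := by ring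
    _ ≤ _ := by
        refine mul_le_mul_of_nonneg_right ?_ (norm_nonneg d)
        rcases abs_cases (1 - η * ((μ + L) / 2)) with ⟨h1, -⟩ | ⟨h1, -⟩ <;> rw [h1]
        · refine le_max_of_le_left (le_trans (le_of_eq ?_) (le_abs_self _)); ring
        · refine le_max_of_le_right (le_trans (le_of_eq ?_) (neg_le_abs _)); ring

theorem eq_zero_of_isMinimizer (hF : ∀ u, HasGradientAt F (g u) u) {x : E}
    (hx : ∀ u, F x ≤ F u) : g x = 0 := by
  have h : IsLocalMin F x := Filter.Eventually.of_forall hx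
  have := h.hasFDerivAt_eq_zero (hF x).hasFDerivAt
  simpa using this

theorem existsUnique_minimizer [ProperSpace E] (hF : ∀ u, HasGradientAt F (g u) u) {μ : ℝ}
    (hμ0 : 0 < μ) (hμ : ∀ u v, μ * ‖u - v‖ ^ 2 ≤ inner ℝ (g u - g v) (u - v)) :
    ∃! x, ∀ u, F x ≤ F u := by
  have hcont : Continuous F :=
    continuous_iff_continuousAt.2 fun u => (hF u).hasFDerivAt.continuousAt
  obtain ⟨x, hx⟩ := hcont.exists_forall_le' 0 <| by
    filter_upwards [(tendsto_norm_cocompact_atTop (E := E)).eventually_ge_atTop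
      (2 * ‖g 0‖ / μ)] with z hz
    have h1 := quadratic_lower_bound hF hμ 0 z
    have h2 := (abs_le.1 (abs_real_inner_le_norm (g 0) z)).1
    rw [sub_zero] at h1
    rw [div_le_iff₀ hμ0] at hz
    nlinarith [mul_le_mul_of_nonneg_right hz (norm_nonneg z)]
  refine ⟨x, hx, fun y hy => ?_⟩
  have h := hμ y x
  rw [eq_zero_of_isMinimizer hF hx, eq_zero_of_isMinimizer hF hy, sub_zero, inner_zero_left] at h
  have : ‖y - x‖ ^ 2 ≤ 0 := by
    by_contra hc
    push Not at hc
    nlinarith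
  exact sub_eq_zero.1 (norm_eq_zero.1 (pow_eq_zero_iff two_ne_zero |>.1
    (le_antisymm this (sq_nonneg _))))

end Convex

/-! ### The weight sequences -/

section Weights

variable {n : ℕ}

theorem vecMul_mem_stdSimplex_of_rowStochastic {A : Matrix (Fin n) (Fin n) ℝ}
    (hA : A ∈ Matrix.rowStochastic ℝ (Fin n)) {v : Fin n → ℝ} (hv : v ∈ stdSimplex ℝ (Fin n)) :
    v ᵥ* A ∈ stdSimplex ℝ (Fin n) := by
  refine ⟨fun j => Matrix.nonneg_vecMul_of_mem_rowStochastic hA hv.1 j, ?_⟩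
  have h := Matrix.dotProduct_mulVec v A 1
  rw [hA.2, dotProduct_one, dotProduct_one, hv.2] at h
  exact h.symm

theorem exists_backward_finite [NeZero n] (N : ℕ) :
    ∀ A : ℕ → Matrix (Fin n) (Fin n) ℝ, (∀ k, A k ∈ Matrix.rowStochastic ℝ (Fin n)) →
      ∃ φ : ℕ → Fin n → ℝ, (∀ k, φ k ∈ stdSimplex ℝ (Fin n)) ∧
        ∀ k < N, φ (k + 1) ᵥ* A k = φ k := by
  induction N with
  | zero =>
    intro A _
    exact ⟨fun _ => Pi.single 0 1, fun _ => single_mem_stdSimplex ℝ 0, by simp⟩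
  | succ N ih =>
    intro A hA
    obtain ⟨φ, hφ, hrel⟩ := ih (fun k => A (k + 1)) fun k => hA (k + 1)
    refine ⟨fun k => Nat.casesOn k (φ 0 ᵥ* A 0) φ, fun k => ?_, fun k hk => ?_⟩
    · cases k with
      | zero => exact vecMul_mem_stdSimplex_of_rowStochastic (hA 0) (hφ 0)
      | succ k => exact hφ k
    · cases k with
      | zero => rfl
      | succ k => exact hrel k (by omega)

/-- Finitely many of the backward relations can be met by starting late; compactness of the
simplices gives a sequence that meets all of them. -/
theorem exists_isStochasticBackward [NeZero n] {A : ℕ → Matrix (Fin n) (Fin n) ℝ}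
    (hA : ∀ k, A k ∈ Matrix.rowStochastic ℝ (Fin n)) :
    ∃ φ : ℕ → Fin n → ℝ, IsStochasticBackward A φ := by
  set S : Set (ℕ → Fin n → ℝ) := Set.univ.pi fun _ => stdSimplex ℝ (Fin n)
  set R : ℕ → Set (ℕ → Fin n → ℝ) := fun N => {φ | ∀ k < N, φ (k + 1) ᵥ* A k = φ k} with hR
  have hS : IsCompact S := isCompact_univ_pi fun _ => isCompact_stdSimplex ℝ (Fin n)
  have hclosed (N : ℕ) : IsClosed (R N) := by
    simp only [hR, Set.ofPred_forall]
    refine isClosed_iInter fun k => isClosed_iInter fun _ => isClosed_eq ?_ (continuous_apply k)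
    exact Continuous.matrix_vecMul (continuous_apply (k + 1)) continuous_const
  obtain ⟨φ, hφ⟩ := IsCompact.nonempty_iInter_of_sequence_nonempty_isCompact_isClosed
    (fun N => S ∩ R N)
    (fun N φ hφ => ⟨hφ.1, fun k hk => hφ.2 k (hk.trans (Nat.lt_succ_self N))⟩)
    (fun N => by
      obtain ⟨φ, h1, h2⟩ := exists_backward_finite N A hA
      exact ⟨φ, fun k _ => h1 k, h2⟩)
    (hS.inter_right (hclosed 0)) (fun N => hS.isClosed.inter (hclosed N))
  rw [Set.mem_iInter] at hφ
  exact ⟨φ, fun k => ⟨(hφ 0).1 k trivial, (hφ (k + 1)).2 k (Nat.lt_succ_self k)⟩⟩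

/-- Every proper subset of the nodes, if nonempty, is entered by an edge from outside. -/
theorem DirWalk.exists_adj_of_notMem_of_mem {G : Digraph (Fin n)} {s : Set (Fin n)} {i j : Fin n}
    (w : DirWalk G i j) : i ∉ s → j ∈ s → ∃ u v, u ∉ s ∧ v ∈ s ∧ G.Adj u v := by
  induction w with
  | nil i => exact fun h h' => absurd h' h
  | @cons i m j h w ih =>
    intro hi hj
    by_cases hm : m ∈ s
    · exact ⟨i, m, hi, hm, h⟩
    · exact ih hm hj

/-- Going back one step the support keeps its nodes, since the diagonals are positive, and gains
one unless it is full, so after `n` steps it is full. -/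
theorem IsStochasticBackward.pos {G : ℕ → Digraph (Fin n)}
    {A : ℕ → Matrix (Fin n) (Fin n) ℝ} (hG : ∀ k, StronglyConnected (G k))
    (hA : ∀ k, PullCompatible (G k) (A k)) (hA0 : ∀ k i j, 0 ≤ A k i j) {φ : ℕ → Fin n → ℝ}
    (hφ : IsStochasticBackward A φ) (k : ℕ) (i : Fin n) : 0 < φ k i := by
  classical
  set s : ℕ → Finset (Fin n) := fun k => Finset.univ.filter fun i => 0 < φ k i with hs
  have hpos (k : ℕ) {i j : Fin n} (hi : 0 < φ (k + 1) i) (hij : 0 < A k i j) : 0 < φ k j := by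
    rw [← (hφ k).2]
    refine (mul_pos hi hij).trans_le (Finset.single_le_sum
      (f := fun i => φ (k + 1) i * A k i j) (fun l _ => ?_) (Finset.mem_univ i))
    exact mul_nonneg ((hφ (k + 1)).1.1 l) (hA0 k l j)
  have hsub (k : ℕ) : s (k + 1) ⊆ s k := fun i hi => by
    simp only [hs, Finset.mem_filter, Finset.mem_univ, true_and] at hi ⊢
    exact hpos k hi ((hA k i i).1 (Or.inr rfl))
  have hne (k : ℕ) : (s k).Nonempty := by
    by_contra h
    rw [Finset.not_nonempty_iff_eq_empty] at h
    have h0 (i : Fin n) : φ k i = 0 := by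
      refine le_antisymm (not_lt.1 fun hi => ?_) ((hφ k).1.1 i)
      exact Finset.notMem_empty i (h ▸ Finset.mem_filter.2 ⟨Finset.mem_univ i, hi⟩)
    have h1 := (hφ k).1.2
    simp [h0] at h1
  have hgrow (k : ℕ) : s (k + 1) ≠ Finset.univ → (s (k + 1)).card < (s k).card := fun hfull => by
    obtain ⟨j, hj⟩ := hne (k + 1)
    obtain ⟨i, hi⟩ : ∃ i, i ∉ s (k + 1) := by
      by_contra! h
      exact hfull (Finset.eq_univ_of_forall h)
    obtain ⟨w⟩ := hG k i j
    obtain ⟨u, v, hu, hv, huv⟩ :=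
      w.exists_adj_of_notMem_of_mem (s := (s (k + 1) : Set (Fin n))) hi hj
    refine Finset.card_lt_card ⟨hsub k, fun hsup => hu (hsup ?_)⟩
    simp only [hs, Finset.coe_filter, Finset.mem_univ, true_and, Set.mem_ofPred_eq,
      Finset.mem_filter] at hv ⊢
    exact hpos k hv ((hA k v u).1 (Or.inl huv))
  have hcard (m : ℕ) : ∀ k, s k = Finset.univ ∨ m < (s k).card := by
    induction m with
    | zero => exact fun k => Or.inr (hne k).card_pos
    | succ m ih =>
      intro k
      by_cases hfull : s (k + 1) = Finset.univ
      · exact Or.inl (Finset.univ_subset_iff.1 (hfull ▸ hsub k))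
      · exact Or.inr ((Nat.succ_le_of_lt ((ih (k + 1)).resolve_left hfull)).trans_lt
          (hgrow k hfull))
  have hall : s k = Finset.univ := (hcard n k).resolve_right fun h => by
    have := Finset.card_le_univ (s k)
    rw [Fintype.card_fin] at this
    omega
  have hi : i ∈ s k := hall ▸ Finset.mem_univ i
  exact (Finset.mem_filter.1 hi).2

theorem piSeq_pos [NeZero n] {G : ℕ → Digraph (Fin n)} {B : ℕ → Matrix (Fin n) (Fin n) ℝ}
    (hB : ∀ k, PushCompatible (G k) (B k)) (hB0 : ∀ k i j, 0 ≤ B k i j) (k : ℕ) :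
    ∀ i, 0 < piSeq B k i := by
  induction k with
  | zero =>
    intro i
    have : (0 : ℝ) < n := Nat.cast_pos.2 (NeZero.pos n)
    simp only [piSeq]
    positivity
  | succ k ih =>
    intro i
    refine (mul_pos ((hB k i i).1 (Or.inr rfl)) (ih i)).trans_le (Finset.single_le_sum
      (f := fun j => B k i j * piSeq B k j) (fun j _ => ?_) (Finset.mem_univ i))
    exact mul_nonneg (hB0 k i j) (ih j).le

theorem sum_piSeq [NeZero n] {B : ℕ → Matrix (Fin n) (Fin n) ℝ}
    (hB1 : ∀ k j, ∑ i, B k i j = 1) (k : ℕ) : ∑ i, piSeq B k i = 1 := by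
  induction k with
  | zero => simp [piSeq]
  | succ k ih =>
    simp only [piSeq, Matrix.mulVec, dotProduct]
    rw [Finset.sum_comm]
    simpa only [← Finset.sum_mul, hB1, one_mul] using ih

end Weights

/-! ### One step of the method -/

section Step

variable {n p : ℕ}

theorem hasGradientAt_avgFun {f : Fin n → EuclideanSpace ℝ (Fin p) → ℝ} {L : ℝ}
    (hf : LipschitzGradients f L) (u : EuclideanSpace ℝ (Fin p)) :
    HasGradientAt (avgFun f) ((1 / (n : ℝ)) • ∑ i, gradient (f i) u) u := by
  have h (i : Fin n) : HasGradientAt (f i) (gradient (f i) u) u :=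
    ((hf i).1.differentiable one_ne_zero u).hasGradientAt
  rw [hasGradientAt_iff_hasFDerivAt, map_smul, map_sum]
  exact (HasFDerivAt.fun_sum fun i _ => (h i).hasFDerivAt).const_mul (1 / (n : ℝ))

theorem norm_sum_gradient_sub_le {f : Fin n → EuclideanSpace ℝ (Fin p) → ℝ} {L : ℝ}
    (hL : 0 ≤ L) (hf : LipschitzGradients f L) (x z : Fin n → EuclideanSpace ℝ (Fin p)) :
    ‖∑ i, (gradient (f i) (x i) - gradient (f i) (z i))‖ ≤
      L * √n * wNorm (fun _ => 1) (fun i => x i - z i) := by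
  have h := sum_norm_le_sqrt_card_mul_wNorm fun i => x i - z i
  rw [Fintype.card_fin] at h
  calc _ ≤ ∑ i, ‖gradient (f i) (x i) - gradient (f i) (z i)‖ := norm_sum_le _ _
    _ ≤ ∑ i, L * ‖x i - z i‖ := Finset.sum_le_sum fun i _ => (hf i).2 _ _
    _ = L * ∑ i, ‖x i - z i‖ := (Finset.mul_sum _ _ _).symm
    _ ≤ L * (√n * wNorm (fun _ => 1) (fun i => x i - z i)) := mul_le_mul_of_nonneg_left h hL
    _ = _ := (mul_assoc _ _ _).symm

theorem norm_gradient_avgFun_sub_le [NeZero n] {f : Fin n → EuclideanSpace ℝ (Fin p) → ℝ} {L : ℝ}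
    (hf : LipschitzGradients f L) (u v : EuclideanSpace ℝ (Fin p)) :
    ‖(1 / (n : ℝ)) • ∑ i, gradient (f i) u - (1 / (n : ℝ)) • ∑ i, gradient (f i) v‖ ≤
      L * ‖u - v‖ := by
  have hn : (0 : ℝ) < n := Nat.cast_pos.2 (NeZero.pos n)
  rw [← smul_sub, ← Finset.sum_sub_distrib, norm_smul, Real.norm_of_nonneg (by positivity)]
  have h : ‖∑ i, (gradient (f i) u - gradient (f i) v)‖ ≤ n * (L * ‖u - v‖) := by
    refine (norm_sum_le_of_le _ fun i _ => (hf i).2 u v).trans ?_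
    simp
  calc _ ≤ 1 / (n : ℝ) * (n * (L * ‖u - v‖)) := mul_le_mul_of_nonneg_left h (by positivity)
    _ = _ := by field_simp

theorem wNorm_one_le_varphiConst_mul [NeZero n] {φ : Fin n → ℝ} (hφ : ∀ i, 0 < φ i)
    (x : Fin n → EuclideanSpace ℝ (Fin p)) :
    wNorm (fun _ => 1) x ≤ varphiConst φ * wNorm φ x := by
  have hm := minEntry_pos hφ
  refine wNorm_le_mul (Real.sqrt_nonneg _) fun i => ?_
  rw [varphiConst, Real.sq_sqrt (by positivity), ← mul_assoc]
  refine mul_le_mul_of_nonneg_right ?_ (sq_nonneg _)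
  rw [one_div_mul_eq_div, le_div_iff₀ hm, one_mul]
  exact minEntry_le φ i

theorem le_one_of_sum_eq_one {w : Fin n → ℝ} (hw : ∀ i, 0 < w i) (hw1 : ∑ i, w i = 1)
    (i : Fin n) : w i ≤ 1 :=
  hw1 ▸ Finset.single_le_sum (f := w) (fun j _ => (hw j).le) (Finset.mem_univ i)

/-- The effective stepsize is `η = α n ⟨φ', π⟩`, and `η₀ = α n min π` is at most `η`. The weighted
mean `⟨φ', π⟩` of the entries of `π` and their minimum add up to at most `1` for `n ≥ 2`, so that
`η + η₀ ≤ α n < 2 / L` and `1 - η c` lies between `-(1 - η₀ c)` and `1 - η₀ c` for `0 < c ≤ L`. -/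
theorem max_abs_le_qConst [NeZero n] {φ' π : Fin n → ℝ} (hφ' : ∀ i, 0 ≤ φ' i)
    (hφ'1 : ∑ i, φ' i = 1) (hπ : ∀ i, 0 < π i) (hπ1 : ∑ i, π i = 1) {μ L α : ℝ} (hμ : 0 < μ)
    (hμL : μ ≤ L) (hα : 0 < α) (hαL : α < 2 / (n * L)) :
    max |1 - α * n * (∑ i, φ' i * π i) * μ| |1 - α * n * (∑ i, φ' i * π i) * L| ≤
      qConst μ L α π := by
  have hn : (0 : ℝ) < n := Nat.cast_pos.2 (NeZero.pos n)
  have hL : 0 < L := hμ.trans_le hμL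
  have hlow : minEntry π ≤ ∑ i, φ' i * π i := by
    calc minEntry π = ∑ i, φ' i * minEntry π := by rw [← Finset.sum_mul, hφ'1, one_mul]
      _ ≤ _ := Finset.sum_le_sum fun i _ => mul_le_mul_of_nonneg_left (minEntry_le π i) (hφ' i)
  by_cases hn1 : n = 1
  · subst hn1
    simp only [Fin.sum_univ_one] at hφ'1 hπ1 ⊢
    simp [qConst, minEntry, hφ'1, hπ1]
  · have hhigh : (∑ i, φ' i * π i) ≤ 1 - minEntry π := by
      have hle (i : Fin n) : π i ≤ 1 - minEntry π := by
        have : Nontrivial (Fin n) := Fin.nontrivial_iff_two_le.2 (by have := NeZero.pos n; omega)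
        obtain ⟨j, hj⟩ := exists_ne i
        have h := Finset.sum_le_sum_of_subset_of_nonneg (f := π) (Finset.subset_univ {i, j})
          fun l _ _ => (hπ l).le
        rw [Finset.sum_pair hj.symm, hπ1] at h
        linarith [minEntry_le π j]
      calc _ ≤ ∑ i, φ' i * (1 - minEntry π) :=
            Finset.sum_le_sum fun i _ => mul_le_mul_of_nonneg_left (hle i) (hφ' i)
        _ = _ := by rw [← Finset.sum_mul, hφ'1, one_mul]
    have hαn : α * n * L < 2 := by
      rw [lt_div_iff₀ (by positivity)] at hαL
      linarith
    have key {c : ℝ} (hc0 : 0 < c) (hcL : c ≤ L) :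
        |1 - α * n * (∑ i, φ' i * π i) * c| ≤ |1 - α * n * minEntry π * c| := by
      have hαc0 : 0 < α * n * c := by positivity
      have hαc : α * n * c ≤ 2 :=
        (mul_le_mul_of_nonneg_left hcL (by positivity)).trans hαn.le
      refine le_trans (abs_le.2 ⟨?_, ?_⟩) (le_abs_self _)
      · nlinarith [mul_le_mul_of_nonneg_left hhigh hαc0.le]
      · nlinarith [mul_le_mul_of_nonneg_left hlow hαc0.le]
    exact max_le_max (key hμ hμL) (key hL le_rfl)

theorem iterates_sum_snd {A B : ℕ → Matrix (Fin n) (Fin n) ℝ}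
    {f : Fin n → EuclideanSpace ℝ (Fin p) → ℝ} {α : ℝ} {x0 : Fin n → EuclideanSpace ℝ (Fin p)}
    (hB1 : ∀ k j, ∑ i, B k i j = 1) (k : ℕ) :
    ∑ i, (iterates A B f α x0 k).2 i = ∑ i, gradient (f i) ((iterates A B f α x0 k).1 i) := by
  induction k with
  | zero => rfl
  | succ k ih =>
    simp only [iterates, Finset.sum_sub_distrib, Finset.sum_add_distrib, ← ih]
    have : ∑ i, ∑ j, B k i j • (iterates A B f α x0 k).2 j =
        ∑ j, (iterates A B f α x0 k).2 j := by
      rw [Finset.sum_comm]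
      simp only [← Finset.sum_smul, hB1, one_smul]
    rw [this]
    abel

theorem wAvg_mix {A : Matrix (Fin n) (Fin n) ℝ} {φ φ' : Fin n → ℝ} (hφ : φ' ᵥ* A = φ)
    (x : Fin n → EuclideanSpace ℝ (Fin p)) : wAvg φ' (fun i => ∑ j, A i j • x j) = wAvg φ x := by
  simp only [wAvg, Finset.smul_sum, smul_smul]
  rw [Finset.sum_comm]
  simp only [← Finset.sum_smul]
  rw [← hφ]
  rfl

theorem dispX_mix_le {G : Digraph (Fin n)} (hG : StronglyConnected G)
    {A : Matrix (Fin n) (Fin n) ℝ} (hA : A ∈ Matrix.rowStochastic ℝ (Fin n))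
    (hAG : PullCompatible G A) {a : ℝ} (ha : 0 < a) (haA : a ≤ minPos A) [NeZero n]
    {φ φ' : Fin n → ℝ} (hφ0 : ∀ i, 0 < φ i) (hφ1 : ∑ i, φ i = 1) (hφ'0 : ∀ i, 0 < φ' i)
    (hφ : φ' ᵥ* A = φ) (x : Fin n → EuclideanSpace ℝ (Fin p)) :
    wNorm φ' (fun i => (∑ j, A i j • x j) - wAvg φ x) ≤ cConst G a φ φ' * dispX x φ := by
  refine wNorm_mix_sub_mean_le hG (fun i => (hφ'0 i).le) (fun i => (hφ0 i).le) hφ1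
    (fun _ _ => Matrix.nonneg_of_mem_rowStochastic hA)
    (Matrix.sum_row_of_mem_rowStochastic hA) (fun j => congrFun hφ j)
    (mul_nonneg (minEntry_pos hφ'0).le (sq_nonneg a)) (fun i j hij => ?_) x
  have h1 : a ≤ A i j := haA.trans (minPos_le ((hAG i j).1 (Or.inl hij)))
  have h2 : a ≤ A i i := haA.trans (minPos_le ((hAG i i).1 (Or.inr rfl)))
  rw [sq]
  exact mul_le_mul (minEntry_le φ' i) (mul_le_mul h1 h2 ha.le (ha.le.trans h1))
    (mul_nonneg ha.le ha.le) (hφ'0 i).le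

/-- In the variables `y i / π i`, mixing with the column-stochastic `B` is averaging with the
row-stochastic matrix with entries `B i j * π j / π' i`. -/
theorem dispY_mix_le {G : Digraph (Fin n)} (hG : StronglyConnected G)
    {B : Matrix (Fin n) (Fin n) ℝ} (hB : B ∈ Matrix.colStochastic ℝ (Fin n))
    (hBG : PushCompatible G B) {b : ℝ} (hb : 0 < b) (hbB : b ≤ minPos B) [NeZero n]
    {π π' : Fin n → ℝ} (hπ0 : ∀ i, 0 < π i) (hπ1 : ∑ i, π i = 1) (hπ'0 : ∀ i, 0 < π' i)
    (hπ : B *ᵥ π = π') (y : Fin n → EuclideanSpace ℝ (Fin p)) :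
    dispY (fun i => ∑ j, B i j • y j) π' ≤ tauConst G b π π' * dispY y π := by
  set C : Matrix (Fin n) (Fin n) ℝ := fun i j => B i j * π j / π' i with hC
  have hB0 (i j : Fin n) : 0 ≤ B i j := Matrix.nonneg_of_mem_colStochastic hB
  have hB1 (j : Fin n) : ∑ i, B i j = 1 := Matrix.sum_col_of_mem_colStochastic hB j
  have hmean : ∑ j, π j • (π j)⁻¹ • y j = ∑ j, y j :=
    Finset.sum_congr rfl fun j _ => smul_inv_smul₀ (hπ0 j).ne' _
  have hsum : ∑ i, ∑ j, B i j • y j = ∑ j, y j := by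
    rw [Finset.sum_comm]
    simp only [← Finset.sum_smul, hB1, one_smul]
  have hmix (i : Fin n) : (π' i)⁻¹ • ∑ j, B i j • y j = ∑ j, C i j • (π j)⁻¹ • y j := by
    rw [Finset.smul_sum]
    refine Finset.sum_congr rfl fun j _ => ?_
    have := (hπ0 j).ne'
    rw [smul_smul, smul_smul]
    congr 1
    simp only [hC]
    field_simp
  have hmin : 0 < minEntry π := minEntry_pos hπ0
  have hmax : 0 < maxEntry π' := maxEntry_pos hπ'0
  have h := wNorm_mix_sub_mean_le (C := C) (m := minEntry π ^ 2 * b ^ 2 / maxEntry π') hG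
    (fun i => (hπ'0 i).le) (fun i => (hπ0 i).le) hπ1
    (fun i j => div_nonneg (mul_nonneg (hB0 i j) (hπ0 j).le) (hπ'0 i).le)
    (fun i => ?_) (fun j => ?_) (by positivity) (fun i j hij => ?_) (fun i => (π i)⁻¹ • y i)
  · rw [hmean] at h
    simp only [← hmix] at h
    rw [div_div] at h
    simp only [dispY, hsum, tauConst]
    refine h.trans (le_of_eq ?_)
    rw [wNorm, show maxEntry π' * (maxEntry π ^ 2 * (diameter G : ℝ) * (maxEdgeUtility G : ℝ)) =
      maxEntry π ^ 2 * maxEntry π' * (diameter G : ℝ) * (maxEdgeUtility G : ℝ) by ring]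
  · simp only [hC]
    rw [← Finset.sum_div, div_eq_one_iff_eq (hπ'0 i).ne', ← hπ]
    rfl
  · have : ∑ i, π' i * C i j = ∑ i, B i j * π j :=
      Finset.sum_congr rfl fun i _ => mul_div_cancel₀ _ (hπ'0 i).ne'
    rw [this, ← Finset.sum_mul, hB1, one_mul]
  · have h1 : b ≤ B i j := hbB.trans (minPos_le ((hBG j i).1 (Or.inl hij)))
    have h2 : b ≤ B i i := hbB.trans (minPos_le ((hBG i i).1 (Or.inr rfl)))
    have h3 : minEntry π * b ≤ π j * B i j :=
      mul_le_mul (minEntry_le π j) h1 hb.le (hπ0 j).le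
    have h4 : minEntry π * b ≤ π i * B i i :=
      mul_le_mul (minEntry_le π i) h2 hb.le (hπ0 i).le
    have h5 : minEntry π ^ 2 * b ^ 2 ≤ (π j * B i j) * (π i * B i i) := by
      refine le_trans (le_of_eq (by ring)) (mul_le_mul h3 h4 (by positivity) ?_)
      exact mul_nonneg (hπ0 j).le (hB0 i j)
    have h6 : π' i * (C i j * C i i) = (π j * B i j) * (π i * B i i) / π' i := by
      have := (hπ'0 i).ne'
      simp only [hC]
      field_simp
    rw [h6]
    exact div_le_div₀ ((by positivity : 0 ≤ minEntry π ^ 2 * b ^ 2).trans h5) h5 (hπ'0 i)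
      (le_maxEntry π' i)

theorem dispY_add_le {π : Fin n → ℝ} (hπ : ∀ i, 0 ≤ π i)
    (y z : Fin n → EuclideanSpace ℝ (Fin p)) :
    dispY (fun i => y i + z i) π ≤ dispY y π + dispY z π := by
  refine le_trans (le_of_eq ?_) (wNorm_add_le hπ (fun i => (π i)⁻¹ • y i - ∑ l, y l)
    fun i => (π i)⁻¹ • z i - ∑ l, z l)
  rw [wNorm, dispY]
  congr 1
  refine Finset.sum_congr rfl fun i _ => ?_
  rw [smul_add, Finset.sum_add_distrib, add_sub_add_comm]

theorem dispY_le_rConst_mul [NeZero n] {π : Fin n → ℝ} (hπ0 : ∀ i, 0 < π i)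
    (hπ1 : ∑ i, π i = 1) (g : Fin n → EuclideanSpace ℝ (Fin p)) :
    dispY g π ≤ rConst π * wNorm (fun _ => 1) g := by
  have hm := minEntry_pos hπ0
  have h1 : dispY g π ≤ wNorm π (fun i => (π i)⁻¹ • g i) + wNorm π (fun _ => ∑ l, g l) :=
    wNorm_sub_le (fun i => (hπ0 i).le) _ _
  have h2 : wNorm π (fun i => (π i)⁻¹ • g i) ≤
      1 / √(minEntry π) * wNorm (fun _ => 1) g := by
    refine wNorm_le_mul (by positivity) fun i => ?_
    have hi := hπ0 i
    rw [norm_smul, mul_pow, Real.norm_of_nonneg (by positivity), ← mul_assoc, div_pow, one_pow,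
      Real.sq_sqrt hm.le, one_mul]
    refine mul_le_mul_of_nonneg_right ?_ (sq_nonneg _)
    rw [show π i * (π i)⁻¹ ^ 2 = 1 / π i by field_simp]
    exact one_div_le_one_div_of_le hm (minEntry_le π i)
  have h3 := (norm_sum_le Finset.univ g).trans (sum_norm_le_sqrt_card_mul_wNorm g)
  rw [Fintype.card_fin] at h3
  rw [wNorm_const hπ1] at h1
  rw [rConst, add_mul]
  linarith

end Step

/-! ### The three coordinates of the error -/

theorem stepMatrix_nonneg {n : ℕ} (G : Digraph (Fin n)) (a b μ : ℝ) {L α : ℝ}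
    (hL : 0 ≤ L) (hα : 0 ≤ α)
    (φ φ' π π' : Fin n → ℝ) (i j : Fin 3) : 0 ≤ stepMatrix G a b L μ α φ φ' π π' i j := by
  have hq : 0 ≤ qConst μ L α π := (abs_nonneg _).trans (le_max_left _ _)
  have hr : 0 ≤ rConst π' := add_nonneg (Real.sqrt_nonneg _) (by positivity)
  have hc : 0 ≤ cConst G a φ φ' := Real.sqrt_nonneg _
  have hτ : 0 ≤ tauConst G b π π' := Real.sqrt_nonneg _
  have hγ : 0 ≤ gammaConst φ' π := Real.sqrt_nonneg _
  have hv : 0 ≤ varphiConst φ := Real.sqrt_nonneg _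
  have hv' : 0 ≤ varphiConst φ' := Real.sqrt_nonneg _
  fin_cases i <;> fin_cases j <;> simp [stepMatrix] <;> positivity

section Rows

variable {n p : ℕ} [NeZero n] {f : Fin n → EuclideanSpace ℝ (Fin p) → ℝ} {L : ℝ}

/-- The gradient trackers, measured from `0` in the scaled variables `y i / π i`; since their sum is
the sum of the gradients, it vanishes at consensus on the minimizer. -/
theorem wNorm_scaled_le (hL : 0 ≤ L) (hf : LipschitzGradients f L) {φ π : Fin n → ℝ}
    (hφ0 : ∀ i, 0 < φ i) (hφ1 : ∑ i, φ i = 1) (hπ0 : ∀ i, 0 < π i) (hπ1 : ∑ i, π i = 1)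
    {x y : Fin n → EuclideanSpace ℝ (Fin p)} (hy : ∑ i, y i = ∑ i, gradient (f i) (x i))
    {xstar : EuclideanSpace ℝ (Fin p)} (hstar : ∑ i, gradient (f i) xstar = 0) :
    wNorm π (fun i => (π i)⁻¹ • y i) ≤
      dispY y π + L * √n * varphiConst φ * (‖wAvg φ x - xstar‖ + dispX x φ) := by
  have h1 := wNorm_add_le (fun i => (hπ0 i).le) (fun i => (π i)⁻¹ • y i - ∑ l, y l)
    fun _ => ∑ l, y l
  simp only [sub_add_cancel] at h1
  rw [wNorm_const hπ1] at h1
  have h2 : ‖∑ i, y i‖ ≤ L * √n * wNorm (fun _ => 1) (fun i => x i - xstar) := by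
    have := norm_sum_gradient_sub_le hL hf x fun _ => xstar
    rwa [Finset.sum_sub_distrib, hstar, sub_zero, ← hy] at this
  have h3 := wNorm_one_le_varphiConst_mul hφ0 fun i => x i - xstar
  have h4 := wNorm_add_le (fun i => (hφ0 i).le) (fun i => x i - wAvg φ x)
    fun _ => wAvg φ x - xstar
  simp only [sub_add_sub_cancel] at h4
  rw [wNorm_const hφ1] at h4
  have hv : 0 ≤ varphiConst φ := Real.sqrt_nonneg _
  have hLn : 0 ≤ L * √n := by positivity
  have h5 : wNorm φ (fun i => x i - xstar) ≤ ‖wAvg φ x - xstar‖ + dispX x φ :=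
    h4.trans (add_comm _ _).le
  have h6 := mul_le_mul_of_nonneg_left (h3.trans (mul_le_mul_of_nonneg_left h5 hv)) hLn
  rw [← mul_assoc] at h6
  exact h1.trans (add_le_add le_rfl (h2.trans h6))

/-- The weighted average makes a gradient step for the average function, of length
`α n ⟨φ', π⟩`, up to the errors of disagreement and of tracking. -/
theorem norm_wAvg_step_sub_le (hL : 0 < L) (hf : LipschitzGradients f L) {μ α : ℝ} (hμ : 0 < μ)
    (hconv : StronglyConvexGrad (avgFun f) μ) (hα : 0 < α) (hαL : α < 2 / (n * L))
    {φ φ' π : Fin n → ℝ} (hφ0 : ∀ i, 0 < φ i) (hφ'0 : ∀ i, 0 < φ' i)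
    (hφ'1 : ∑ i, φ' i = 1) (hπ0 : ∀ i, 0 < π i) (hπ1 : ∑ i, π i = 1)
    {A : Matrix (Fin n) (Fin n) ℝ} (hφ : φ' ᵥ* A = φ)
    {x y : Fin n → EuclideanSpace ℝ (Fin p)} (hy : ∑ i, y i = ∑ i, gradient (f i) (x i))
    {xstar : EuclideanSpace ℝ (Fin p)} (hstar : ∑ i, gradient (f i) xstar = 0) :
    ‖wAvg φ' (fun i => (∑ j, A i j • x j) - α • y i) - xstar‖ ≤
      qConst μ L α π * ‖wAvg φ x - xstar‖ + α * L * √n * varphiConst φ * dispX x φ +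
        α * dispY y π := by
  have hD : 0 ≤ dispX x φ := Real.sqrt_nonneg _
  have hS : 0 ≤ dispY y π := Real.sqrt_nonneg _
  have hv : 0 ≤ varphiConst φ := Real.sqrt_nonneg _
  have hq : 0 ≤ qConst μ L α π := (abs_nonneg _).trans (le_max_left _ _)
  rcases subsingleton_or_nontrivial (EuclideanSpace ℝ (Fin p)) with hE | hE
  · -- in dimension `0` the constants `μ` and `L` need not be ordered, but all norms vanish
    rw [norm_of_subsingleton]
    positivity
  have hn : (0 : ℝ) < n := Nat.cast_pos.2 (NeZero.pos n)
  set g : EuclideanSpace ℝ (Fin p) → EuclideanSpace ℝ (Fin p) :=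
    fun u => (1 / (n : ℝ)) • ∑ i, gradient (f i) u with hg
  have hF (u) : HasGradientAt (avgFun f) (g u) u := hasGradientAt_avgFun hf u
  have hmono : ∀ u v, μ * ‖u - v‖ ^ 2 ≤ inner ℝ (g u - g v) (u - v) := fun u v => by
    have := hconv u v
    rwa [(hF u).gradient, (hF v).gradient] at this
  have hLip : ∀ u v, ‖g u - g v‖ ≤ L * ‖u - v‖ := norm_gradient_avgFun_sub_le hf
  have hμL : μ ≤ L := le_of_strongly_monotone_lipschitz hmono hLip
  set xh := wAvg φ x with hxh
  set s := ∑ i, φ' i * π i with hs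
  have hs0 : 0 ≤ s := Finset.sum_nonneg fun i _ => mul_nonneg (hφ'0 i).le (hπ0 i).le
  have hs1 : s ≤ 1 := by
    rw [hs, ← hπ1]
    exact Finset.sum_le_sum fun i _ => mul_le_of_le_one_left (hπ0 i).le
      (le_one_of_sum_eq_one hφ'0 hφ'1 i)
  set Δ := ∑ i, (gradient (f i) (x i) - gradient (f i) xh) with hΔ
  set R := ∑ i, π i • φ' i • ((π i)⁻¹ • y i - ∑ l, y l) with hR
  have hgstar : g xstar = 0 := by simp only [hg, hstar, smul_zero]
  have hysum : ∑ i, y i = (n : ℝ) • g xh + Δ := by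
    rw [hΔ, Finset.sum_sub_distrib, hy, hg, smul_smul, mul_one_div_cancel hn.ne', one_smul]
    abel
  have hwy : ∑ i, φ' i • y i = s • ∑ i, y i + R := by
    rw [hR, hs, Finset.sum_smul, ← Finset.sum_add_distrib]
    refine Finset.sum_congr rfl fun i _ => ?_
    have := (hπ0 i).ne'
    rw [smul_sub, smul_sub, smul_smul, smul_smul, smul_smul, mul_comm (φ' i) (π i)]
    rw [show π i * φ' i * (π i)⁻¹ = φ' i by field_simp]
    abel
  have havg : wAvg φ' (fun i => (∑ j, A i j • x j) - α • y i) = xh - α • ∑ i, φ' i • y i := by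
    rw [hxh, ← wAvg_mix hφ x]
    simp only [wAvg, smul_sub, Finset.sum_sub_distrib, Finset.smul_sum]
    congr 1
    exact Finset.sum_congr rfl fun i _ => smul_comm _ _ _
  have hsplit : wAvg φ' (fun i => (∑ j, A i j • x j) - α • y i) - xstar =
      ((xh - xstar) - (α * n * s) • (g xh - g xstar)) - (α * s) • Δ - α • R := by
    rw [havg, hwy, hysum, hgstar]
    module
  have hstep := (norm_gradient_step_le hF hmono hLip hμL (by positivity : 0 ≤ α * n * s) xh
    xstar).trans (mul_le_mul_of_nonneg_right
      (max_abs_le_qConst (fun i => (hφ'0 i).le) hφ'1 hπ0 hπ1 hμ hμL hα hαL) (norm_nonneg _))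
  have hΔle : ‖Δ‖ ≤ L * √n * varphiConst φ * dispX x φ := by
    refine (norm_sum_gradient_sub_le hL.le hf x fun _ => xh).trans ?_
    rw [mul_assoc (L * √n)]
    exact mul_le_mul_of_nonneg_left (wNorm_one_le_varphiConst_mul hφ0 _) (by positivity)
  have hRle : ‖R‖ ≤ dispY y π := by
    refine (norm_sum_smul_le_wNorm (fun i => (hπ0 i).le) hπ1 _).trans ?_
    refine (wNorm_le_mul (w' := π) (z := fun i => (π i)⁻¹ • y i - ∑ l, y l) zero_le_one
      fun i => ?_).trans (one_mul _).le
    rw [one_pow, one_mul, norm_smul, Real.norm_of_nonneg (hφ'0 i).le]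
    refine mul_le_mul_of_nonneg_left ?_ (hπ0 i).le
    exact pow_le_pow_left₀ (mul_nonneg (hφ'0 i).le (norm_nonneg _))
      (mul_le_of_le_one_left (norm_nonneg _) (le_one_of_sum_eq_one hφ'0 hφ'1 i)) 2
  calc _ ≤ ‖(xh - xstar) - (α * n * s) • (g xh - g xstar)‖ + ‖(α * s) • Δ‖ + ‖α • R‖ := by
        rw [hsplit]
        exact (norm_sub_le _ _).trans (add_le_add (norm_sub_le _ _) le_rfl)
    _ ≤ qConst μ L α π * ‖xh - xstar‖ + α * (L * √n * varphiConst φ * dispX x φ) +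
        α * dispY y π := by
      rw [norm_smul, norm_smul, Real.norm_of_nonneg hα.le,
        Real.norm_of_nonneg (mul_nonneg hα.le hs0)]
      refine add_le_add (add_le_add hstep ?_) (mul_le_mul_of_nonneg_left hRle hα.le)
      exact mul_le_mul (mul_le_of_le_one_right hα.le hs1) hΔle (norm_nonneg _) hα.le
    _ = _ := by ring

theorem dispX_step_le {G : Digraph (Fin n)} (hG : StronglyConnected G)
    {A : Matrix (Fin n) (Fin n) ℝ} (hA : A ∈ Matrix.rowStochastic ℝ (Fin n))
    (hAG : PullCompatible G A) {a α : ℝ} (ha : 0 < a) (haA : a ≤ minPos A) (hα : 0 ≤ α)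
    {φ φ' π : Fin n → ℝ} (hφ0 : ∀ i, 0 < φ i) (hφ1 : ∑ i, φ i = 1) (hφ'0 : ∀ i, 0 < φ' i)
    (hφ'1 : ∑ i, φ' i = 1) (hφ : φ' ᵥ* A = φ) (hπ0 : ∀ i, 0 < π i)
    (x y : Fin n → EuclideanSpace ℝ (Fin p)) :
    dispX (fun i => (∑ j, A i j • x j) - α • y i) φ' ≤
      cConst G a φ φ' * dispX x φ +
        α * gammaConst φ' π * wNorm π (fun i => (π i)⁻¹ • y i) := by
  have hmix := dispX_mix_le hG hA hAG ha haA hφ0 hφ1 hφ'0 hφ x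
  have hy : wNorm φ' y ≤ gammaConst φ' π * wNorm π (fun i => (π i)⁻¹ • y i) := by
    have hle (i : Fin n) : φ' i * π i ≤ maxEntry fun j => φ' j * π j :=
      le_maxEntry (fun j => φ' j * π j) i
    refine wNorm_le_mul (Real.sqrt_nonneg _) fun i => ?_
    have hi := hπ0 i
    have hprod := mul_pos (hφ'0 i) hi
    rw [gammaConst, Real.sq_sqrt (hprod.le.trans (hle i)), norm_smul, mul_pow,
      Real.norm_of_nonneg (by positivity)]
    calc φ' i * ‖y i‖ ^ 2 = φ' i * π i * (π i * ((π i)⁻¹ ^ 2 * ‖y i‖ ^ 2)) := by field_simp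
      _ ≤ _ := mul_le_mul_of_nonneg_right (hle i) (by positivity)
  have hsub := wNorm_sub_mean_le hφ'1 y
  have hsplit : dispX (fun i => (∑ j, A i j • x j) - α • y i) φ' =
      wNorm φ' (fun i => ((∑ j, A i j • x j) - wAvg φ x) -
        α • (y i - ∑ j, φ' j • y j)) := by
    rw [dispX, wNorm]
    congr 1
    refine Finset.sum_congr rfl fun i _ => ?_
    have : wAvg φ' (fun i => (∑ j, A i j • x j) - α • y i) =
        wAvg φ x - α • ∑ j, φ' j • y j := by
      rw [← wAvg_mix hφ x]
      simp only [wAvg, smul_sub, Finset.sum_sub_distrib, Finset.smul_sum]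
      congr 1
      exact Finset.sum_congr rfl fun i _ => smul_comm _ _ _
    rw [this, smul_sub, sub_sub_sub_comm]
  have htri := wNorm_sub_le (fun i => (hφ'0 i).le) (fun i => (∑ j, A i j • x j) - wAvg φ x)
    fun i => α • (y i - ∑ j, φ' j • y j)
  rw [wNorm_smul φ' hα] at htri
  rw [hsplit, mul_assoc]
  exact htri.trans (add_le_add hmix (mul_le_mul_of_nonneg_left (hsub.trans hy) hα))

/-- The displacement of the nodes in one step, in the unweighted norm: mixing and disagreement are
both measured from the weighted average, which mixing preserves. -/
theorem wNorm_one_sub_step_le {G : Digraph (Fin n)} (hG : StronglyConnected G)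
    {A : Matrix (Fin n) (Fin n) ℝ} (hA : A ∈ Matrix.rowStochastic ℝ (Fin n))
    (hAG : PullCompatible G A) {a α : ℝ} (ha : 0 < a) (haA : a ≤ minPos A) (hα : 0 ≤ α)
    {φ φ' π : Fin n → ℝ} (hφ0 : ∀ i, 0 < φ i) (hφ1 : ∑ i, φ i = 1) (hφ'0 : ∀ i, 0 < φ' i)
    (hφ : φ' ᵥ* A = φ) (hπ0 : ∀ i, 0 < π i) (hπ1 : ∑ i, π i = 1)
    (x y : Fin n → EuclideanSpace ℝ (Fin p)) :
    wNorm (fun _ => 1) (fun i => (∑ j, A i j • x j) - α • y i - x i) ≤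
      (cConst G a φ φ' * varphiConst φ' + varphiConst φ) * dispX x φ +
        α * wNorm π (fun i => (π i)⁻¹ • y i) := by
  have hone : ∀ i : Fin n, (0 : ℝ) ≤ 1 := fun _ => zero_le_one
  have hmix := (wNorm_one_le_varphiConst_mul hφ'0
    fun i => (∑ j, A i j • x j) - wAvg φ x).trans (mul_le_mul_of_nonneg_left
      (dispX_mix_le hG hA hAG ha haA hφ0 hφ1 hφ'0 hφ x) (Real.sqrt_nonneg _))
  have hx := wNorm_one_le_varphiConst_mul hφ0 fun i => x i - wAvg φ x
  have hy : wNorm (fun _ => 1) y ≤ wNorm π (fun i => (π i)⁻¹ • y i) := by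
    refine (wNorm_le_mul zero_le_one fun i => ?_).trans (one_mul _).le
    have hi := hπ0 i
    rw [norm_smul, mul_pow, Real.norm_of_nonneg (by positivity), one_pow, one_mul, one_mul,
      ← mul_assoc]
    refine le_mul_of_one_le_left (sq_nonneg _) ?_
    rw [show π i * (π i)⁻¹ ^ 2 = 1 / π i by field_simp]
    exact (one_le_div hi).2 (le_one_of_sum_eq_one hπ0 hπ1 i)
  have h1 := wNorm_sub_le hone
    (fun i => ((∑ j, A i j • x j) - wAvg φ x) - (x i - wAvg φ x)) fun i => α • y i
  have h2 := wNorm_sub_le hone (fun i => (∑ j, A i j • x j) - wAvg φ x) fun i => x i - wAvg φ x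
  rw [wNorm_smul _ hα] at h1
  have h3 := mul_le_mul_of_nonneg_left hy hα
  have heq : (fun i => (∑ j, A i j • x j) - α • y i - x i) =
      fun i => ((∑ j, A i j • x j) - wAvg φ x) - (x i - wAvg φ x) - α • y i := by
    funext i
    abel
  rw [heq]
  change _ ≤ varphiConst φ * dispX x φ at hx
  linarith

theorem dispY_step_le (hL : 0 ≤ L) (hf : LipschitzGradients f L)
    {G : Digraph (Fin n)} (hG : StronglyConnected G)
    {B : Matrix (Fin n) (Fin n) ℝ} (hB : B ∈ Matrix.colStochastic ℝ (Fin n))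
    (hBG : PushCompatible G B) {b : ℝ} (hb : 0 < b) (hbB : b ≤ minPos B)
    {π π' : Fin n → ℝ} (hπ0 : ∀ i, 0 < π i) (hπ1 : ∑ i, π i = 1) (hπ'0 : ∀ i, 0 < π' i)
    (hπ'1 : ∑ i, π' i = 1) (hπ : B *ᵥ π = π') (x x' y : Fin n → EuclideanSpace ℝ (Fin p)) :
    dispY (fun i => (∑ j, B i j • y j) + gradient (f i) (x' i) - gradient (f i) (x i)) π' ≤
      tauConst G b π π' * dispY y π +
        L * rConst π' * wNorm (fun _ => 1) (fun i => x' i - x i) := by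
  have hr : 0 ≤ rConst π' := add_nonneg (Real.sqrt_nonneg _) (by positivity)
  have h1 := dispY_add_le (fun i => (hπ'0 i).le) (fun i => ∑ j, B i j • y j)
    fun i => gradient (f i) (x' i) - gradient (f i) (x i)
  simp only [← add_sub_assoc] at h1
  have h2 := dispY_le_rConst_mul hπ'0 hπ'1 fun i => gradient (f i) (x' i) - gradient (f i) (x i)
  have h3 : wNorm (fun _ => 1) (fun i => gradient (f i) (x' i) - gradient (f i) (x i)) ≤
      L * wNorm (fun _ => 1) (fun i => x' i - x i) := by
    refine wNorm_le_mul hL fun i => ?_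
    rw [one_mul, one_mul, ← mul_pow]
    exact pow_le_pow_left₀ (norm_nonneg _) ((hf i).2 _ _) 2
  have h4 := mul_le_mul_of_nonneg_left h3 hr
  have h5 := dispY_mix_le hG hB hBG hb hbB hπ0 hπ1 hπ'0 hπ y
  linarith

end Rows

end PushPull

theorem mainTheorem2 (n p : ℕ) (hn : 1 ≤ n)
    (G : ℕ → Digraph (Fin n)) (A B : ℕ → Matrix (Fin n) (Fin n) ℝ)
    (f : Fin n → EuclideanSpace ℝ (Fin p) → ℝ)
    (a b L μ α : ℝ) (x0 : Fin n → EuclideanSpace ℝ (Fin p))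
    (hG : ∀ k, PushPull.StronglyConnected (G k))
    (hA : ∀ k, A k ∈ Matrix.rowStochastic ℝ (Fin n) ∧ PushPull.PullCompatible (G k) (A k))
    (ha : 0 < a) (hAa : ∀ k, a ≤ PushPull.minPos (A k))
    (hB : ∀ k, B k ∈ Matrix.colStochastic ℝ (Fin n) ∧ PushPull.PushCompatible (G k) (B k))
    (hb : 0 < b) (hBb : ∀ k, b ≤ PushPull.minPos (B k))
    (hL : 0 < L) (hf : PushPull.LipschitzGradients f L)
    (hμ : 0 < μ) (hconv : PushPull.StronglyConvexGrad (PushPull.avgFun f) μ)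
    (hα : 0 < α) (hαL : α < 2 / (n * L)) :
    (∃! xstar, ∀ u, PushPull.avgFun f xstar ≤ PushPull.avgFun f u) ∧
    (∃ φ : ℕ → Fin n → ℝ, PushPull.IsStochasticBackward A φ) ∧
    (∀ k i, 0 < PushPull.piSeq B k i) ∧
    ∀ xstar, (∀ u, PushPull.avgFun f xstar ≤ PushPull.avgFun f u) →
    ∀ φ : ℕ → Fin n → ℝ, PushPull.IsStochasticBackward A φ →
      (∀ k i, 0 < φ k i) ∧
      ∀ k : ℕ,
        (∀ i j, 0 ≤ PushPull.stepMatrix (G k) a b L μ α (φ k) (φ (k + 1))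
          (PushPull.piSeq B k) (PushPull.piSeq B (k + 1)) i j) ∧
        PushPull.errVec xstar (φ (k + 1)) (PushPull.piSeq B (k + 1))
            (PushPull.iterates A B f α x0 (k + 1)) ≤
          PushPull.stepMatrix (G k) a b L μ α (φ k) (φ (k + 1))
              (PushPull.piSeq B k) (PushPull.piSeq B (k + 1)) *ᵥ
            PushPull.errVec xstar (φ k) (PushPull.piSeq B k)
              (PushPull.iterates A B f α x0 k) := by
  have : NeZero n := ⟨by omega⟩
  have hn0 : (0 : ℝ) < n := Nat.cast_pos.2 hn
  have hF := PushPull.hasGradientAt_avgFun hf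
  have hmono : ∀ u v, μ * ‖u - v‖ ^ 2 ≤ inner ℝ ((1 / (n : ℝ)) • ∑ i, gradient (f i) u -
      (1 / (n : ℝ)) • ∑ i, gradient (f i) v) (u - v) := fun u v => by
    have := hconv u v
    rwa [(hF u).gradient, (hF v).gradient] at this
  have hB0 (k i j) : 0 ≤ B k i j := Matrix.nonneg_of_mem_colStochastic (hB k).1
  have hB1 (k j) : ∑ i, B k i j = 1 := Matrix.sum_col_of_mem_colStochastic (hB k).1 j
  have hπ0 : ∀ k i, 0 < PushPull.piSeq B k i := PushPull.piSeq_pos (fun k => (hB k).2) hB0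
  have hπ1 : ∀ k, ∑ i, PushPull.piSeq B k i = 1 := PushPull.sum_piSeq hB1
  refine ⟨PushPull.existsUnique_minimizer hF hμ hmono,
    PushPull.exists_isStochasticBackward fun k => (hA k).1, hπ0, fun xstar hmin φ hφ => ?_⟩
  have hφ0 : ∀ k i, 0 < φ k i := hφ.pos hG (fun k => (hA k).2)
    fun k i j => Matrix.nonneg_of_mem_rowStochastic (hA k).1
  refine ⟨hφ0, fun k => ⟨PushPull.stepMatrix_nonneg _ _ _ _ hL.le hα.le _ _ _ _, ?_⟩⟩
  have hstar : ∑ i, gradient (f i) xstar = 0 := by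
    have := PushPull.eq_zero_of_isMinimizer hF hmin
    exact (smul_eq_zero.1 this).resolve_left (by positivity)
  have hφ1 (k) : ∑ i, φ k i = 1 := (hφ k).1.2
  have hy := PushPull.iterates_sum_snd (A := A) (f := f) (α := α) (x0 := x0) hB1 k
  simp only [PushPull.iterates]
  set x := (PushPull.iterates A B f α x0 k).1
  set y := (PushPull.iterates A B f α x0 k).2
  set π := PushPull.piSeq B k
  have row1 := PushPull.norm_wAvg_step_sub_le hL hf hμ hconv hα hαL (hφ0 k) (hφ0 (k + 1))
    (hφ1 (k + 1)) (hπ0 k) (hπ1 k) (hφ k).2 hy hstar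
  have row2 := PushPull.dispX_step_le (hG k) (hA k).1 (hA k).2 ha (hAa k) hα.le (hφ0 k) (hφ1 k)
    (hφ0 (k + 1)) (hφ1 (k + 1)) (hφ k).2 (hπ0 k) x y
  have move := PushPull.wNorm_one_sub_step_le (hG k) (hA k).1 (hA k).2 ha (hAa k) hα.le (hφ0 k)
    (hφ1 k) (hφ0 (k + 1)) (hφ k).2 (hπ0 k) (hπ1 k) x y
  have row3 := PushPull.dispY_step_le hL.le hf (hG k) (hB k).1 (hB k).2 hb (hBb k) (hπ0 k) (hπ1 k)
    (hπ0 (k + 1)) (hπ1 (k + 1)) rfl x (fun i => (∑ j, A k i j • x j) - α • y i) y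
  have track := PushPull.wNorm_scaled_le hL.le hf (hφ0 k) (hφ1 k) (hπ0 k) (hπ1 k) hy hstar
  have hγ : 0 ≤ PushPull.gammaConst (φ (k + 1)) π := Real.sqrt_nonneg _
  have hr : 0 ≤ PushPull.rConst (PushPull.piSeq B (k + 1)) :=
    add_nonneg (Real.sqrt_nonneg _) (by positivity)
  intro i
  fin_cases i <;> simp [PushPull.errVec, PushPull.stepMatrix, Matrix.mulVec]
  · rw [← add_assoc]
    exact row1
  · have := mul_le_mul_of_nonneg_left track (mul_nonneg hα.le hγ)
    refine row2.trans ?_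
    linarith
  · have h1 := mul_le_mul_of_nonneg_left move (mul_nonneg hL.le hr)
    have h2 := mul_le_mul_of_nonneg_left track (mul_nonneg (mul_nonneg hL.le hr) hα.le)
    refine row3.trans ?_
    linarith
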